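/- **Setting.** Let $\epsilon>0$ and let $K$ be $2\epsilon^{-1/2}$ rounded (up or down) to an integer. In a separable real Hilbert space consider, with respect to an orthonormal system, $$w^*=(1,1,0,0,\dots)^\top,\quad \sigma^2=1,\quad H=\mathrm{diag}(1,\underbrace{\epsilon^{0.5},\dots,\epsilon^{0.5}}_{K\text{ copies}},0,0,\dots),\quad G=\mathrm{diag}(\epsilon^2,1,0,0,\dots).$$ The source and target covariate laws have finite fourth moments $\mathbb E\|x\|^4<\infty$ and second moments $\mathbb E_{\rm source}[xx^\top]=G$, $\mathbb E_{\rm target}[xx^\top]=H$; in both domains $y=\langle w^*,x\rangle+\xi$ with $\xi\sim\mathcal N(0,1)$ independent of $x$. Given $M$ source data followed by $N$ target data, all independent, SGD starts at $w_0=0$ and iterates $$w_t=w_{t-1}-\gamma_{t-1}(x_tx_t^\top w_{t-1}-x_ty_t),\quad t=1,\dots,M+N,$$ where $\gamma_t=\gamma_0/2^{\lfloor t/(M/\log M)\rfloor}$ for $0\le t<M$ and $\gamma_t=\gamma_M/2^{\lfloor (t-M)/(N/\log N)\rfloor}$ for $M\le t<M+N$ (natural logarithm; the exponent is read as $0$ for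 a phase of length one). Let $R_{\rm target}(w)=\tfrac12\mathbb E_{\rm target}(y-\langle w,x\rangle)^2$ and let $\Delta(M,N)=\mathbb E[R_{\rm target}(w_{M+N})]-R_{\rm target}(w^*)$ be the expected target excess risk of the output. The initial stepsizes are positive. **Claim.** For all sufficiently small $\epsilon$, $\mathrm{tr}(H)\eqsim\mathrm{tr}(G)\eqsim 1$ and $\|w^*\|_H^2\eqsim\|w^*\|_G^2\eqsim1$, and: * **Supervised learning.** There are absolute constants $c,\epsilon_0>0$ such that for all $\epsilon<\epsilon_0$, all such laws, all $N$ and all initial stepsizes $\gamma_M<1/\|H\|_2$: if $\Delta(0,N)<\epsilon$ then $N\ge c\,\epsilon^{-1.5}$. * **Pretraining.** There are absolute constants $c,\epsilon_0>0$ such that for all $\epsilon<\epsilon_0$, all such laws, all $M$ and all initial stepsizes $\gamma_0<1/\|G\|_2$: if $\Delta(M,0)<\epsilon$ then $M\ge c\,\epsilon^{-2}$. * **Pretraining–finetuning.** There is an absolute constant $\kappa>0$ such that for every $\alpha>0$ and all constants $a_0,a_1,a_2,a_3>0$ and $b_1,b_2,b_3$ with $a_1a_3\ge\kappa$ there is $\epsilon_0>0$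 such that the following holds for all $\epsilon<\epsilon_0$. Suppose that the covariate laws also satisfy $\mathbb E_{\rm source}[xx^\top Axx^\top]\preceq\alpha\,\mathrm{tr}(GA)\,G$ and $\mathbb E_{\rm target}[xx^\top Axx^\top]\preceq\alpha\,\mathrm{tr}(HA)\,H$ for every bounded positive semidefinite $A$. If $$a_0\le\gamma_0<\min\Big\{\tfrac1{4\alpha\,\mathrm{tr}(G)},\tfrac1{4\alpha\,\mathrm{tr}(H)}\Big\},\quad a_1\epsilon\le\gamma_M\le b_1\epsilon,$$ $$a_2\,\epsilon^{-1}\log(\epsilon^{-1})\le M\le b_2\,\epsilon^{-1}\log(\epsilon^{-1}),\quad a_3\,\epsilon^{-1}\log^2(\epsilon^{-1})\le N\le b_3\,\epsilon^{-1}\log^2(\epsilon^{-1}),$$ then the excess risk of $w_{M+N}$ has finite expectation and $\Delta(M,N)<\epsilon$. That is, $\gamma_0\eqsim1$, $\gamma_M\eqsim\epsilon$, $M\eqsim\epsilon^{-1}\log(\epsilon^{-1})$, $N\eqsim\epsilon^{-1}\log^2(\epsilon^{-1})$ suffices, polynomially fewer data than either pretraining or supervised learning alone needs. -/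

import Mathlib

open MeasureTheory ProbabilityTheory

section Definitions

universe u

variable {E : Type u} [NormedAddCommGroup E] [InnerProductSpace ℝ E]

/-- The operator `∑ i, s i • e i (e i)ᵀ`; for an orthonormal family `e` this is
`diag (s 0, …, s (n-1), 0, 0, …)` in any orthonormal basis that extends `e`. -/
noncomputable def diagOp {n : ℕ} (e : Fin n → E) (s : Fin n → ℝ) : E →L[ℝ] E :=
  ∑ i, s i • InnerProductSpace.rankOne ℝ (e i) (e i)

/-- `tr (T A)` for `T = diagOp e s` and a bounded operator `A` (`e` orthonormal). -/
noncomputable def traceDiagMul {n : ℕ} (e : Fin n → E) (s : Fin n → ℝ) (A : E →L[ℝ] E) : ℝ :=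
  ∑ i, s i * inner ℝ (e i) (A (e i))

/-- `‖w‖²_T = wᵀ T w`. -/
noncomputable def normSqOp (T : E →L[ℝ] E) (w : E) : ℝ := inner ℝ w (T w)

/-- `(1, ε^{0.5}, …, ε^{0.5})` with `K` copies of `ε^{0.5}`. -/
noncomputable def targetSpectrum (ε : ℝ) (K : ℕ) (i : Fin (K + 1)) : ℝ :=
  if i = 0 then 1 else ε ^ (1 / 2 : ℝ)

/-- `(ε², 1, 0, …, 0)`. -/
noncomputable def sourceSpectrum (ε : ℝ) (K : ℕ) (i : Fin (K + 1)) : ℝ :=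
  if i = 0 then ε ^ 2 else if i = 1 then 1 else 0

/-- The stepsizes. In each of the two phases (of length `M` and `N`) the stepsize is halved after
every `M / log M` (respectively `N / log N`) steps. -/
noncomputable def stepSize (γ₀ γM : ℝ) (M N t : ℕ) : ℝ :=
  if t < M then γ₀ / 2 ^ ⌊(t : ℝ) / (M / Real.log M)⌋₊
  else γM / 2 ^ ⌊((t : ℝ) - M) / (N / Real.log N)⌋₊

/-- Online SGD from `0` for linear regression: step `t` uses the datum `z t = (x, y)`. -/
noncomputable def sgd (γ : ℕ → ℝ) (z : ℕ → E × ℝ) : ℕ → E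
  | 0 => 0
  | t + 1 => sgd γ z t
      - γ t • (inner ℝ (z t).1 (sgd γ z t) • (z t).1 - (z t).2 • (z t).1)

variable [MeasurableSpace E]

/-- The operator `T` is the (uncentred) covariance `𝔼[x xᵀ]` of the covariate law `P`. -/
def HasSecondMoment (P : Measure E) (T : E →L[ℝ] E) : Prop :=
  ∀ u v : E, ∫ x, inner ℝ u x * inner ℝ v x ∂P = inner ℝ u (T v)

/-- `𝔼[x xᵀ A x xᵀ] ≼ α · tr (T A) · T` for every positive semidefinite `A`, where
`T = diagOp e s`. -/
def FourthMomentUpper {n : ℕ} (α : ℝ) (P : Measure E) (e : Fin n → E) (s : Fin n → ℝ) : Prop :=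
  ∀ A : E →L[ℝ] E, A.IsPositive → ∀ v : E,
    ∫ x, (inner ℝ v x) ^ 2 * inner ℝ x (A x) ∂P
      ≤ α * traceDiagMul e s A * inner ℝ v (diagOp e s v)

/-- The law of `(x, y)` with `x ∼ P` and `y = ⟨w, x⟩ + ξ`, where `ξ ∼ 𝒩(0, 1)` is independent
of `x`. -/
noncomputable def dataLaw (P : Measure E) (w : E) : Measure (E × ℝ) :=
  (P.prod (gaussianReal 0 1)).map fun p => (p.1, inner ℝ w p.1 + p.2)

/-- The population risk `½ 𝔼 (y - ⟨w, x⟩)²`. -/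
noncomputable def risk (D : Measure (E × ℝ)) (w : E) : ℝ :=
  1 / 2 * ∫ p, (p.2 - inner ℝ w p.1) ^ 2 ∂D

instance dataLaw_isProbabilityMeasure [BorelSpace E] [SecondCountableTopology E]
    (P : Measure E) [IsProbabilityMeasure P] (w : E) : IsProbabilityMeasure (dataLaw P w) := by
  unfold dataLaw
  exact Measure.isProbabilityMeasure_map (by fun_prop)

/-- The law of the `t`-th datum (counted from `0`): source data first, then target data. -/
noncomputable def datumLaw (PS PT : Measure E) (w : E) (M t : ℕ) : Measure (E × ℝ) :=
  if t < M then dataLaw PS w else dataLaw PT w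

instance datumLaw_isProbabilityMeasure [BorelSpace E] [SecondCountableTopology E]
    (PS PT : Measure E) [IsProbabilityMeasure PS] [IsProbabilityMeasure PT] (w : E) (M t : ℕ) :
    IsProbabilityMeasure (datumLaw PS PT w M t) := by
  unfold datumLaw
  split_ifs <;> infer_instance

/-- The covariate shift problem instance: `G = diag (ε², 1, 0, …)`,
`H = diag (1, ε^{0.5}, …, ε^{0.5}, 0, …)` with `K` copies of `ε^{0.5}`, where `K` is `2 ε^{-0.5}`
rounded (up or down) to an integer, in an orthonormal system `e` of the Hilbert space `E`. The
covariate laws are `PS` (source) and `PT` (target). -/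
structure ShiftInstance (ε : ℝ) (E : Type u) [NormedAddCommGroup E] [InnerProductSpace ℝ E]
    [MeasurableSpace E] where
  K : ℕ
  copies : |(K : ℝ) - 2 * ε ^ (-(1 / 2) : ℝ)| < 1
  e : Fin (K + 1) → E
  orthonormal : Orthonormal ℝ e
  PS : Measure E
  PT : Measure E
  isProbS : IsProbabilityMeasure PS
  isProbT : IsProbabilityMeasure PT
  fourthMomentS : Integrable (fun x => ‖x‖ ^ 4) PS
  fourthMomentT : Integrable (fun x => ‖x‖ ^ 4) PT
  secondMomentS : HasSecondMoment PS (diagOp e (sourceSpectrum ε K))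
  secondMomentT : HasSecondMoment PT (diagOp e (targetSpectrum ε K))

namespace ShiftInstance

attribute [instance] ShiftInstance.isProbS ShiftInstance.isProbT

variable {ε : ℝ} (I : ShiftInstance ε E)

/-- The source covariance. -/
noncomputable def G : E →L[ℝ] E := diagOp I.e (sourceSpectrum ε I.K)

/-- The target covariance. -/
noncomputable def H : E →L[ℝ] E := diagOp I.e (targetSpectrum ε I.K)

noncomputable def traceG : ℝ := ∑ i, sourceSpectrum ε I.K i

noncomputable def traceH : ℝ := ∑ i, targetSpectrum ε I.K i

/-- `w* = (1, 1, 0, 0, …)`. -/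
noncomputable def wStar : E := I.e 0 + I.e 1

/-- The target domain excess risk. -/
noncomputable def excessRisk (w : E) : ℝ :=
  risk (dataLaw I.PT I.wStar) w - risk (dataLaw I.PT I.wStar) I.wStar

/-- The fourth moment condition with constant `α`, for source and target. -/
def FourthMoment (α : ℝ) : Prop :=
  FourthMomentUpper α I.PS I.e (sourceSpectrum ε I.K) ∧
    FourthMomentUpper α I.PT I.e (targetSpectrum ε I.K)

/-- The excess risk of the output `w_{M+N}` of SGD run on the data sequence `z`. -/
noncomputable def outputRisk (γ₀ γM : ℝ) (M N : ℕ) (z : ℕ → E × ℝ) : ℝ :=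
  I.excessRisk (sgd (stepSize γ₀ γM M N) z (M + N))

variable [BorelSpace E] [SecondCountableTopology E]

/-- The joint law of the independent data: `M` source data followed by target data (of which
SGD uses the first `N`). -/
noncomputable def dataMeasure (M : ℕ) : Measure (ℕ → E × ℝ) :=
  Measure.infinitePi (datumLaw I.PS I.PT I.wStar M)

/-- The expected excess risk of `w_{M+N}`. -/
noncomputable def expectedRisk (γ₀ γM : ℝ) (M N : ℕ) : ℝ :=
  ∫ z, I.outputRisk γ₀ γM M N z ∂(I.dataMeasure M)

end ShiftInstance

end Definitions

/-!
Along an eigenvector of the covariance, the mean square error of SGD obeys a scalar recursion: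
Jensen's inequality bounds it below, and the fourth moment condition bounds it above, up to a
feedback through the total excess risk which the stepsize condition keeps bounded.

Supervised learning has to move the iterate along `e 1`, an eigenvector of eigenvalue `ε ^ (1 / 2)`.
The stepsizes that this requires add noise along all `K ≈ 2 * ε ^ (-1 / 2)` eigenvectors with this
eigenvalue, and by the Cauchy–Schwarz inequality this noise contributes at least order `K / N` to
the excess risk. Pretraining shrinks the error along `e 0` only by a factor `1 - O(ε ^ 2)` per step.

Finetuning combines the two domains. The source phase reduces the error along `e 1` below a small
multiple of `ε ^ (1 / 2)` and leaves the coordinates `i ≥ 2` exact. In the target phase the first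
stage of the geometric schedule contracts the error along `e 0`, a later stage contracts the noise
accumulated by the earlier ones, and the coordinates `i ≥ 1` together pick up noise of order
`N * γM ^ 2` only.
-/

open InnerProductSpace Finset Filter Topology
open scoped RealInnerProductSpace

section Noise

variable {X : Type*} [MeasurableSpace X] {P : Measure X} {ν : Measure ℝ} [IsProbabilityMeasure ν]
  {f g : X → ℝ}

lemma memLp_add_mul_noise (hf : MemLp f 2 P) (hg : MemLp g 2 P) (hν : MemLp id 2 ν) :
    MemLp (fun p : X × ℝ => f p.1 + g p.1 * p.2) 2 (P.prod ν) := by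
  have hgν : MemLp (fun p : X × ℝ => g p.1 * p.2) 2 (P.prod ν) := by
    refine (memLp_two_iff_integrable_sq (hg.1.comp_fst.mul hν.1.comp_snd)).2 ?_
    simpa only [Pi.mul_apply, mul_pow] using hg.integrable_sq.mul_prod hν.integrable_sq
  exact (hf.comp_fst ν).add hgν

lemma integral_sq_add_mul_noise [SFinite P] (hf : MemLp f 2 P) (hg : MemLp g 2 P)
    (hν : MemLp id 2 ν) (hν0 : ∫ ξ, ξ ∂ν = 0) :
    ∫ p : X × ℝ, (f p.1 + g p.1 * p.2) ^ 2 ∂P.prod ν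
      = ∫ x, f x ^ 2 ∂P + (∫ x, g x ^ 2 ∂P) * ∫ ξ, ξ ^ 2 ∂ν := by
  have hsq : Integrable (fun p : X × ℝ => f p.1 ^ 2) (P.prod ν) := hf.integrable_sq.comp_fst ν
  have hcross : Integrable (fun p : X × ℝ => 2 * (f p.1 * g p.1 * p.2)) (P.prod ν) :=
    ((hf.integrable_mul hg).mul_prod (hν.integrable one_le_two)).const_mul 2
  have hsum : Integrable (fun p : X × ℝ => f p.1 ^ 2 + 2 * (f p.1 * g p.1 * p.2)) (P.prod ν) :=
    hsq.add hcross
  have hnoise : Integrable (fun p : X × ℝ => g p.1 ^ 2 * p.2 ^ 2) (P.prod ν) :=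
    hg.integrable_sq.mul_prod hν.integrable_sq
  calc ∫ p : X × ℝ, (f p.1 + g p.1 * p.2) ^ 2 ∂P.prod ν
      = ∫ p : X × ℝ, (f p.1 ^ 2 + 2 * (f p.1 * g p.1 * p.2) + g p.1 ^ 2 * p.2 ^ 2)
          ∂P.prod ν := by
        congr with p
        ring
    _ = ∫ x, f x ^ 2 ∂P + 2 * ((∫ x, f x * g x ∂P) * ∫ ξ, ξ ∂ν)
          + (∫ x, g x ^ 2 ∂P) * ∫ ξ, ξ ^ 2 ∂ν := by
        rw [integral_add hsum hnoise, integral_add hsq hcross, integral_const_mul,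
          integral_prod_mul (fun x => f x * g x) fun ξ : ℝ => ξ,
          integral_prod_mul (fun x => g x ^ 2) fun ξ : ℝ => ξ ^ 2,
          integral_fun_fst fun x => f x ^ 2]
        simp
    _ = _ := by rw [hν0, mul_zero, mul_zero, add_zero]

lemma integral_sq_gaussianReal_zero_one : ∫ ξ, ξ ^ 2 ∂gaussianReal 0 1 = 1 := by
  simpa [variance_eq_integral measurable_id.aemeasurable, integral_id_gaussianReal] using
    variance_id_gaussianReal (μ := 0) (v := 1)

lemma integral_sq_add_mul_gaussian [SFinite P] (hf : MemLp f 2 P) (hg : MemLp g 2 P) :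
    ∫ p : X × ℝ, (f p.1 + g p.1 * p.2) ^ 2 ∂P.prod (gaussianReal 0 1)
      = ∫ x, f x ^ 2 ∂P + ∫ x, g x ^ 2 ∂P := by
  rw [integral_sq_add_mul_noise hf hg (memLp_id_gaussianReal 2) integral_id_gaussianReal,
    integral_sq_gaussianReal_zero_one, mul_one]

end Noise

section Moments

lemma sq_integral_le_integral_sq {X : Type*} [MeasurableSpace X] {P : Measure X}
    [IsProbabilityMeasure P] {f : X → ℝ} (hf : MemLp f 2 P) :
    (∫ x, f x ∂P) ^ 2 ≤ ∫ x, f x ^ 2 ∂P :=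
  sub_nonneg.1 ((variance_nonneg f P).trans_eq (variance_eq_sub hf))

instance holderTriple_four_four_two : ENNReal.HolderTriple 4 4 2 where
  inv_add_inv_eq_inv := by
    rw [← two_mul, show (4 : ENNReal) = 2 * 2 by norm_num,
      ENNReal.mul_inv (Or.inl two_ne_zero) (Or.inl ENNReal.ofNat_ne_top), ← mul_assoc,
      ENNReal.mul_inv_cancel two_ne_zero ENNReal.ofNat_ne_top, one_mul]

lemma memLp_four_of_integrable_norm_pow {E : Type*} [NormedAddCommGroup E] [MeasurableSpace E]
    [BorelSpace E] [SecondCountableTopology E] {P : Measure E}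
    (hP : Integrable (fun x => ‖x‖ ^ 4) P) : MemLp id 4 P :=
  (integrable_norm_rpow_iff (p := 4) (by fun_prop) four_ne_zero ENNReal.ofNat_ne_top).1
    (hP.congr (ae_of_all _ fun x => by
      simp only [id, ENNReal.toReal_ofNat, Real.rpow_ofNat]))

variable {E : Type*} [NormedAddCommGroup E] [InnerProductSpace ℝ E] [MeasurableSpace E]
  {P : Measure E}

lemma memLp_inner_mul_inner (hP : MemLp id 4 P) (u v : E) :
    MemLp (fun x => ⟪u, x⟫ * ⟪v, x⟫) 2 P :=
  (hP.const_inner v).mul (hP.const_inner u)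

lemma HasSecondMoment.integral_inner_sq {T : E →L[ℝ] E} (hT : HasSecondMoment P T) (u : E) :
    ∫ x, ⟪u, x⟫ ^ 2 ∂P = ⟪u, T u⟫ := by
  simpa only [sq] using hT u u

lemma memLp_sub_mul_inner_mul_inner [IsFiniteMeasure P] (hP : MemLp id 4 P)
    (γ : ℝ) (u v : E) (a : ℝ) : MemLp (fun x => a - γ * (⟪u, x⟫ * ⟪v, x⟫)) 2 P :=
  (memLp_const a).sub ((memLp_inner_mul_inner hP u v).const_mul γ)

variable {T : E →L[ℝ] E}

lemma integral_sub_mul_inner_mul_inner [IsProbabilityMeasure P] (hP : MemLp id 4 P)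
    (hT : HasSecondMoment P T) (γ : ℝ) (u v : E) (a : ℝ) :
    ∫ x, (a - γ * (⟪u, x⟫ * ⟪v, x⟫)) ∂P = a - γ * ⟪u, T v⟫ := by
  rw [integral_sub (integrable_const a)
    (((memLp_inner_mul_inner hP u v).integrable one_le_two).const_mul γ), integral_const_mul, hT]
  simp

lemma integral_sq_sub_mul_inner_mul_inner [IsProbabilityMeasure P] (hP : MemLp id 4 P)
    (hT : HasSecondMoment P T) (γ : ℝ) (u v : E) (a : ℝ) :
    ∫ x, (a - γ * (⟪u, x⟫ * ⟪v, x⟫)) ^ 2 ∂P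
      = a ^ 2 - 2 * a * γ * ⟪u, T v⟫ + γ ^ 2 * ∫ x, (⟪u, x⟫ * ⟪v, x⟫) ^ 2 ∂P := by
  have hq := memLp_inner_mul_inner hP u v
  have hlin : Integrable (fun x => a ^ 2 - 2 * a * γ * (⟪u, x⟫ * ⟪v, x⟫)) P :=
    (integrable_const _).sub ((hq.integrable one_le_two).const_mul _)
  rw [← hT u v, ← integral_const_mul, ← integral_const_mul,
    ← show ∫ _, a ^ 2 ∂P = a ^ 2 by simp,
    ← integral_sub (integrable_const _) ((hq.integrable one_le_two).const_mul _),
    ← integral_add hlin (hq.integrable_sq.const_mul _)]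
  congr with x
  ring

end Moments

section Regression

variable {E : Type*} [NormedAddCommGroup E] [InnerProductSpace ℝ E] [MeasurableSpace E]
  [BorelSpace E] [SecondCountableTopology E] {P : Measure E}

lemma integral_dataLaw (w : E) {f : E × ℝ → ℝ} (hf : Measurable f) :
    ∫ p, f p ∂dataLaw P w
      = ∫ p : E × ℝ, f (p.1, ⟪w, p.1⟫ + p.2) ∂P.prod (gaussianReal 0 1) :=
  integral_map (by fun_prop) hf.aestronglyMeasurable

lemma memLp_fst_dataLaw {p : ENNReal} (hP : MemLp id p P) (w : E) :
    MemLp Prod.fst p (dataLaw P w) :=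
  (memLp_map_measure_iff (by fun_prop) (by fun_prop)).2 (hP.comp_fst (gaussianReal 0 1))

variable [IsProbabilityMeasure P]

lemma memLp_smul_dataLaw (hP : MemLp id 4 P) (w : E) :
    MemLp (fun p : E × ℝ => p.2 • p.1) 2 (dataLaw P w) := by
  refine (memLp_map_measure_iff (by fun_prop) (by fun_prop)).2 ?_
  refine (memLp_norm_iff (by fun_prop)).1 ?_
  have h := memLp_add_mul_noise (hP.norm.mul (r := 2) (hP.const_inner w))
    (hP.norm.mono_exponent (by norm_num)) (memLp_id_gaussianReal (μ := 0) (v := 1) 2)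
  refine h.norm.congr_norm (by fun_prop) (ae_of_all _ fun p => ?_)
  rw [norm_norm, Function.comp_apply, norm_smul, Pi.mul_apply, mul_comm ‖id p.1‖ p.2, ← add_mul,
    norm_mul, norm_norm]
  simp only [id, norm_mul, norm_norm]

lemma risk_dataLaw (hP : MemLp id 2 P) {T : E →L[ℝ] E} (hT : HasSecondMoment P T) (w v : E) :
    risk (dataLaw P w) v = 1 / 2 * (⟪v - w, T (v - w)⟫ + 1) := by
  have h := integral_sq_add_mul_gaussian (hP.const_inner (v - w)) (memLp_const (-1 : ℝ))
  simp only [id, hT.integral_inner_sq, integral_const, probReal_univ, smul_eq_mul, one_mul,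
    neg_one_sq] at h
  rw [risk, integral_dataLaw w (by fun_prop), ← h]
  congr with p
  simp only [inner_sub_left]
  ring

lemma risk_sub_risk (hP : MemLp id 2 P) {T : E →L[ℝ] E} (hT : HasSecondMoment P T) (w v : E) :
    risk (dataLaw P w) v - risk (dataLaw P w) w = 1 / 2 * ⟪v - w, T (v - w)⟫ := by
  rw [risk_dataLaw hP hT, risk_dataLaw hP hT, sub_self, map_zero, inner_zero_right]
  ring

lemma integral_sq_inner_sgdStep (hP : MemLp id 4 P) {T : E →L[ℝ] E} (hT : HasSecondMoment P T)
    (γ : ℝ) (u v w : E) :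
    ∫ p, ⟪u, v - γ • (⟪p.1, v⟫ • p.1 - p.2 • p.1) - w⟫ ^ 2 ∂dataLaw P w
      = ∫ x, (⟪u, v - w⟫ - γ * (⟪u, x⟫ * ⟪v - w, x⟫)) ^ 2 ∂P + γ ^ 2 * ⟪u, T u⟫ := by
  have h := integral_sq_add_mul_gaussian (memLp_sub_mul_inner_mul_inner hP γ u (v - w) ⟪u, v - w⟫)
    (((hP.mono_exponent (by norm_num : (2 : ENNReal) ≤ 4)).const_inner u).const_mul γ)
  simp only [id, mul_pow γ, integral_const_mul, hT.integral_inner_sq] at h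
  rw [integral_dataLaw w (by fun_prop), ← h]
  congr with p
  simp only [inner_sub_left, inner_sub_right, inner_smul_right, real_inner_comm p.1 v,
    real_inner_comm p.1 w]
  ring

end Regression

section Trajectory

variable {E : Type*} [NormedAddCommGroup E] [InnerProductSpace ℝ E]

lemma sgd_congr (γ : ℕ → ℝ) {z z' : ℕ → E × ℝ} {t : ℕ} (h : ∀ s < t, z s = z' s) :
    sgd γ z t = sgd γ z' t := by
  induction t with
  | zero => rfl
  | succ t ih => rw [sgd, sgd, ih fun s hs => h s (hs.trans t.lt_succ_self), h t t.lt_succ_self]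

variable [MeasurableSpace E] [BorelSpace E]

lemma memLp_inner_smul_of_indepFun {Ω : Type*} [MeasurableSpace Ω] {μ : Measure Ω} {X Y : Ω → E}
    (hXY : IndepFun Y X μ) (hX : MemLp X 4 μ) (hY : MemLp Y 2 μ) :
    MemLp (fun ω => ⟪X ω, Y ω⟫ • X ω) 2 μ := by
  have hbound : MemLp (fun ω => ‖Y ω‖ * ‖X ω‖ ^ 2) 2 μ := by
    refine (memLp_two_iff_integrable_sq (hY.1.norm.mul (hX.1.norm.pow 2))).2 ?_
    have hind : IndepFun (fun ω => ‖Y ω‖ ^ 2) (fun ω => ‖X ω‖ ^ 4) μ :=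
      hXY.comp (measurable_norm.pow_const 2) (measurable_norm.pow_const 4)
    convert hind.integrable_mul (hY.integrable_norm_pow two_ne_zero)
      (MemLp.integrable_norm_pow (p := 4) hX four_ne_zero) using 2 with ω
    simp only [Pi.mul_apply, Pi.pow_apply]
    ring
  refine hbound.mono ((hX.1.inner hY.1).smul hX.1) (ae_of_all _ fun ω => ?_)
  calc ‖⟪X ω, Y ω⟫ • X ω‖ = ‖⟪X ω, Y ω⟫‖ * ‖X ω‖ := norm_smul _ _
    _ ≤ ‖X ω‖ * ‖Y ω‖ * ‖X ω‖ := by gcongr; exact norm_inner_le_norm _ _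
    _ = ‖Y ω‖ * ‖X ω‖ ^ 2 := by ring
    _ ≤ ‖‖Y ω‖ * ‖X ω‖ ^ 2‖ := le_abs_self _

variable [SecondCountableTopology E]

@[fun_prop]
lemma measurable_sgd (γ : ℕ → ℝ) (t : ℕ) : Measurable fun z : ℕ → E × ℝ => sgd γ z t := by
  induction t with
  | zero => exact measurable_const
  | succ t ih =>
    simp only [sgd]
    fun_prop

variable {D : ℕ → Measure (E × ℝ)} [∀ t, IsProbabilityMeasure (D t)]

lemma indepFun_sgd_eval (γ : ℕ → ℝ) (t : ℕ) :
    IndepFun (fun z : ℕ → E × ℝ => sgd γ z t) (fun z => z t) (Measure.infinitePi D) := by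
  have hindep : iIndepFun (fun (i : ℕ) (z : ℕ → E × ℝ) => z i) (Measure.infinitePi D) :=
    iIndepFun_infinitePi (X := fun _ p => p) fun _ => measurable_id
  let extend (r : range t → E × ℝ) (s : ℕ) : E × ℝ := if hs : s ∈ range t then r ⟨s, hs⟩ else 0
  have hextend : Measurable extend := by
    refine measurable_pi_lambda _ fun s => ?_
    by_cases hs : s ∈ range t
    · simpa only [extend, hs, dite_true] using measurable_pi_apply _
    · simpa only [extend, hs, dite_false] using measurable_const
  have hpast : (fun z : ℕ → E × ℝ => sgd γ z t)
      = ((fun z => sgd γ z t) ∘ extend) ∘ fun z (i : range t) => z i := by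
    funext z
    exact sgd_congr γ fun s hs => by simp [extend, hs]
  rw [hpast]
  exact (hindep.indepFun_finset (range t) {t} (by simp) measurable_pi_apply).comp
    ((measurable_sgd γ t).comp hextend) (measurable_pi_apply (⟨t, by simp⟩ : ({t} : Finset ℕ)))

lemma map_sgd_eval (γ : ℕ → ℝ) (t : ℕ) :
    (Measure.infinitePi D).map (fun z => (sgd γ z t, z t))
      = ((Measure.infinitePi D).map fun z => sgd γ z t).prod (D t) := by
  rw [(indepFun_iff_map_prod_eq_prod_map_map (measurable_sgd γ t).aemeasurable
    (measurable_pi_apply t).aemeasurable).1 (indepFun_sgd_eval γ t),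
    (measurePreserving_eval_infinitePi D t).map_eq]

lemma memLp_sgd (hx : ∀ t, MemLp Prod.fst 4 (D t))
    (hyx : ∀ t, MemLp (fun p : E × ℝ => p.2 • p.1) 2 (D t)) (γ : ℕ → ℝ) (t : ℕ) :
    MemLp (fun z => sgd γ z t) 2 (Measure.infinitePi D) := by
  induction t with
  | zero => exact memLp_const 0
  | succ t ih =>
    have heval := measurePreserving_eval_infinitePi D t
    have hind : IndepFun (fun z => sgd γ z t) (fun z => (z t).1) (Measure.infinitePi D) :=
      (indepFun_sgd_eval γ t).comp measurable_id measurable_fst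
    exact ih.sub (((memLp_inner_smul_of_indepFun hind ((hx t).comp_measurePreserving heval) ih).sub
      ((hyx t).comp_measurePreserving heval)).const_smul (γ t))

variable {γ : ℕ → ℝ} {t : ℕ} {f : E × (E × ℝ) → ℝ}

lemma integrable_prod_of_integrable_sgd_eval (hf : Measurable f)
    (hi : Integrable (fun z => f (sgd γ z t, z t)) (Measure.infinitePi D)) :
    Integrable f (((Measure.infinitePi D).map fun z => sgd γ z t).prod (D t)) := by
  rw [← map_sgd_eval]
  exact (integrable_map_measure hf.aestronglyMeasurable (by fun_prop)).2 hi

lemma integrable_integral_sgd_eval (hf : Measurable f)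
    (hi : Integrable (fun z => f (sgd γ z t, z t)) (Measure.infinitePi D)) :
    Integrable (fun z => ∫ p, f (sgd γ z t, p) ∂D t) (Measure.infinitePi D) :=
  (integrable_prod_of_integrable_sgd_eval hf hi).integral_prod_left.comp_measurable
    (measurable_sgd γ t)

lemma integral_sgd_eval (hf : Measurable f)
    (hi : Integrable (fun z => f (sgd γ z t, z t)) (Measure.infinitePi D)) :
    ∫ z, f (sgd γ z t, z t) ∂Measure.infinitePi D
      = ∫ z, ∫ p, f (sgd γ z t, p) ∂D t ∂Measure.infinitePi D := by
  have hprod := integrable_prod_of_integrable_sgd_eval hf hi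
  rw [← integral_map (φ := fun z => (sgd γ z t, z t)) (by fun_prop) hf.aestronglyMeasurable,
    map_sgd_eval, integral_prod _ hprod,
    integral_map (by fun_prop) hprod.integral_prod_left.aestronglyMeasurable]

end Trajectory

section DirectionalError

variable {E : Type*} [NormedAddCommGroup E] [InnerProductSpace ℝ E] [MeasurableSpace E]

/-- The joint law of independent data from the linear model `y = ⟨w, x⟩ + ξ`, where the `t`-th
covariate has law `P t`. -/
noncomputable def regressionMeasure (P : ℕ → Measure E) (w : E) : Measure (ℕ → E × ℝ) :=
  Measure.infinitePi fun t => dataLaw (P t) w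

/-- The mean square error of the `t`-th iterate of SGD in the direction `u`, for data from the
linear model with parameter `w`. -/
noncomputable def directionalError (P : ℕ → Measure E) (γ : ℕ → ℝ) (w u : E) (t : ℕ) : ℝ :=
  ∫ z, ⟪u, sgd γ z t - w⟫ ^ 2 ∂regressionMeasure P w

variable {P : ℕ → Measure E} {γ : ℕ → ℝ} {w u : E} {t : ℕ}

lemma directionalError_nonneg : 0 ≤ directionalError P γ w u t :=
  integral_nonneg fun _ => sq_nonneg _

variable [BorelSpace E] [SecondCountableTopology E] [∀ t, IsProbabilityMeasure (P t)]

instance regressionMeasure_isProbabilityMeasure : IsProbabilityMeasure (regressionMeasure P w) := by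
  unfold regressionMeasure
  infer_instance

lemma directionalError_zero : directionalError P γ w u 0 = ⟪u, w⟫ ^ 2 := by
  simp [directionalError, sgd]

lemma integrable_sq_inner_sgd_sub (hP : ∀ t, MemLp id 4 (P t)) :
    Integrable (fun z => ⟪u, sgd γ z t - w⟫ ^ 2) (regressionMeasure P w) := by
  have hsgd : MemLp (fun z => sgd γ z t) 2 (regressionMeasure P w) :=
    memLp_sgd (fun t => memLp_fst_dataLaw (hP t) w) (fun t => memLp_smul_dataLaw (hP t) w) γ t
  exact ((hsgd.sub (memLp_const w)).const_inner u).integrable_sq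

variable {T : E →L[ℝ] E}

lemma integrable_integral_sq_sgdStep (hP : ∀ t, MemLp id 4 (P t)) (hT : HasSecondMoment (P t) T) :
    Integrable (fun z => ∫ x, (⟪u, sgd γ z t - w⟫ - γ t * (⟪u, x⟫ * ⟪sgd γ z t - w, x⟫)) ^ 2 ∂P t)
      (regressionMeasure P w) := by
  have h := integrable_integral_sgd_eval (γ := γ) (t := t) (f := fun q : E × (E × ℝ) =>
      ⟪u, q.1 - γ t • (⟪q.2.1, q.1⟫ • q.2.1 - q.2.2 • q.2.1) - w⟫ ^ 2)
    (by fun_prop) (integrable_sq_inner_sgd_sub (t := t + 1) hP)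
  simp only [integral_sq_inner_sgdStep (hP t) hT] at h
  refine (h.sub (integrable_const (γ t ^ 2 * ⟪u, T u⟫))).congr (ae_of_all _ fun z => ?_)
  exact add_sub_cancel_right _ _

lemma directionalError_succ (hP : ∀ t, MemLp id 4 (P t)) (hT : HasSecondMoment (P t) T) :
    directionalError P γ w u (t + 1)
      = ∫ z, ∫ x, (⟪u, sgd γ z t - w⟫ - γ t * (⟪u, x⟫ * ⟪sgd γ z t - w, x⟫)) ^ 2 ∂P t
          ∂regressionMeasure P w + γ t ^ 2 * ⟪u, T u⟫ := by
  have h := integral_sgd_eval (γ := γ) (t := t) (f := fun q : E × (E × ℝ) =>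
      ⟪u, q.1 - γ t • (⟪q.2.1, q.1⟫ • q.2.1 - q.2.2 • q.2.1) - w⟫ ^ 2)
    (by fun_prop) (integrable_sq_inner_sgd_sub (t := t + 1) hP)
  simp only [integral_sq_inner_sgdStep (hP t) hT] at h
  refine h.trans <|
    (integral_add (integrable_integral_sq_sgdStep hP hT) (integrable_const _)).trans ?_
  rw [integral_const, probReal_univ, one_smul]

lemma le_directionalError_succ (hP : ∀ t, MemLp id 4 (P t)) (hT : HasSecondMoment (P t) T)
    {s : ℝ} (hu : ∀ v, ⟪u, T v⟫ = s * ⟪u, v⟫) :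
    (1 - γ t * s) ^ 2 * directionalError P γ w u t + γ t ^ 2 * ⟪u, T u⟫
      ≤ directionalError P γ w u (t + 1) := by
  have herr := integrable_sq_inner_sgd_sub hP (γ := γ) (t := t) (w := w) (u := u)
  rw [directionalError_succ hP hT, directionalError, ← integral_const_mul]
  refine add_le_add (integral_mono (herr.const_mul _) (integrable_integral_sq_sgdStep hP hT)
    fun z => ?_) le_rfl
  have hjensen := sq_integral_le_integral_sq
    (memLp_sub_mul_inner_mul_inner (hP t) (γ t) u (sgd γ z t - w) ⟪u, sgd γ z t - w⟫)
  rw [integral_sub_mul_inner_mul_inner (hP t) hT, hu] at hjensen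
  exact le_of_eq_of_le (by ring) hjensen

end DirectionalError

section Diagonal

variable {E : Type*} [NormedAddCommGroup E] [InnerProductSpace ℝ E] {n : ℕ} {e : Fin n → E}
  {s : Fin n → ℝ}

lemma inner_diagOp (u v : E) : ⟪u, diagOp e s v⟫ = ∑ i, s i * (⟪e i, v⟫ * ⟪e i, u⟫) := by
  simp [diagOp, inner_sum, inner_smul_right, real_inner_comm]

lemma inner_self_diagOp (v : E) : ⟪v, diagOp e s v⟫ = ∑ i, s i * ⟪e i, v⟫ ^ 2 := by
  simp only [inner_diagOp, sq]

lemma inner_orthonormal_diagOp (he : Orthonormal ℝ e) (i : Fin n) (v : E) :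
    ⟪e i, diagOp e s v⟫ = s i * ⟪e i, v⟫ := by
  simp [inner_diagOp, orthonormal_iff_ite.1 he]

lemma traceDiagMul_rankOne (he : Orthonormal ℝ e) (i : Fin n) :
    traceDiagMul e s (rankOne ℝ (e i) (e i)) = s i := by
  simp only [traceDiagMul, rankOne_apply, inner_smul_right, orthonormal_iff_ite.1 he]
  simp

variable [MeasurableSpace E] {α : ℝ}

lemma integral_sq_inner_mul_inner_le {Q : Measure E} (he : Orthonormal ℝ e)
    (h : FourthMomentUpper α Q e s) (i : Fin n) (v : E) :
    ∫ x, (⟪e i, x⟫ * ⟪v, x⟫) ^ 2 ∂Q ≤ α * s i * ∑ j, s j * ⟪e j, v⟫ ^ 2 := by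
  rw [← inner_self_diagOp, ← traceDiagMul_rankOne (s := s) he i]
  refine le_of_eq_of_le ?_ (h _ (isPositive_rankOne_self (e i)) v)
  congr with x
  rw [rankOne_apply, inner_smul_right, real_inner_comm]
  ring

lemma one_le_of_fourthMomentUpper {Q : Measure E} [IsProbabilityMeasure Q] (hQ : MemLp id 4 Q)
    (he : Orthonormal ℝ e) (hT : HasSecondMoment Q (diagOp e s)) (hα : FourthMomentUpper α Q e s)
    {i : Fin n} (hi : s i = 1) : 1 ≤ α := by
  have hjensen := sq_integral_le_integral_sq (memLp_inner_mul_inner hQ (e i) (e i))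
  have hfourth := integral_sq_inner_mul_inner_le he hα i (e i)
  rw [hT, inner_orthonormal_diagOp he, hi, real_inner_self_eq_norm_sq, he.1 i] at hjensen
  rw [← inner_self_diagOp, inner_orthonormal_diagOp he, hi, real_inner_self_eq_norm_sq, he.1 i]
    at hfourth
  linarith

variable [BorelSpace E] [SecondCountableTopology E] {P : ℕ → Measure E}
  [∀ t, IsProbabilityMeasure (P t)] {γ : ℕ → ℝ} {w : E} {t : ℕ}

lemma directionalError_succ_le (hP : ∀ t, MemLp id 4 (P t)) (he : Orthonormal ℝ e)
    (hT : HasSecondMoment (P t) (diagOp e s)) (hα : FourthMomentUpper α (P t) e s) (i : Fin n) :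
    directionalError P γ w (e i) (t + 1)
      ≤ (1 - 2 * γ t * s i) * directionalError P γ w (e i) t
        + γ t ^ 2 * s i * (1 + α * ∑ j, s j * directionalError P γ w (e j) t) := by
  have herr (j) := integrable_sq_inner_sgd_sub hP (γ := γ) (t := t) (w := w) (u := e j)
  have hsum : Integrable (fun z => ∑ j, s j * ⟪e j, sgd γ z t - w⟫ ^ 2) (regressionMeasure P w) :=
    integrable_finsetSum _ fun j _ => (herr j).const_mul _
  have hstep : ∫ z, ∫ x, (⟪e i, sgd γ z t - w⟫
        - γ t * (⟪e i, x⟫ * ⟪sgd γ z t - w, x⟫)) ^ 2 ∂P t ∂regressionMeasure P w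
      ≤ ∫ z, ((1 - 2 * γ t * s i) * ⟪e i, sgd γ z t - w⟫ ^ 2
        + γ t ^ 2 * (α * s i) * ∑ j, s j * ⟪e j, sgd γ z t - w⟫ ^ 2) ∂regressionMeasure P w := by
    refine integral_mono (integrable_integral_sq_sgdStep hP hT)
      (((herr i).const_mul _).add (hsum.const_mul _)) fun z => ?_
    have hfourth := mul_le_mul_of_nonneg_left
      (integral_sq_inner_mul_inner_le he hα i (sgd γ z t - w)) (sq_nonneg (γ t))
    simp only [integral_sq_sub_mul_inner_mul_inner (hP t) hT, inner_orthonormal_diagOp he]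
    linarith
  rw [integral_add ((herr i).const_mul _) (hsum.const_mul _), integral_const_mul,
    integral_const_mul, integral_finsetSum _ fun j _ => (herr j).const_mul _] at hstep
  simp only [integral_const_mul] at hstep
  rw [directionalError_succ hP hT, inner_orthonormal_diagOp he, real_inner_self_eq_norm_sq, he.1 i]
  unfold directionalError
  linarith

end Diagonal

section ScalarRecursions

variable {v x u g : ℕ → ℝ} {C l h : ℝ} {n a b : ℕ}

lemma mul_prod_sq_le_of_recursion (hv : ∀ t < n, (1 - x t) ^ 2 * v t ≤ v (t + 1)) :
    v 0 * (∏ t ∈ range n, (1 - x t)) ^ 2 ≤ v n := by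
  induction n with
  | zero => simp
  | succ n ih =>
    calc v 0 * (∏ t ∈ range (n + 1), (1 - x t)) ^ 2
        = (1 - x n) ^ 2 * (v 0 * (∏ t ∈ range n, (1 - x t)) ^ 2) := by
          rw [prod_range_succ]
          ring
      _ ≤ (1 - x n) ^ 2 * v n := by
          gcongr
          exact ih fun t ht => hv t (ht.trans n.lt_succ_self)
      _ ≤ v (n + 1) := hv n n.lt_succ_self

lemma sq_add_le_succ_mul {p q y : ℝ} (hq : 0 ≤ q) (hp : p ^ 2 ≤ n * q) :
    (p + y) ^ 2 ≤ (n + 1) * (q + y ^ 2) := by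
  rcases n.eq_zero_or_pos with rfl | hn
  · have : p = 0 := by
      rw [Nat.cast_zero, zero_mul] at hp
      exact pow_eq_zero_iff two_ne_zero |>.1 (le_antisymm hp (sq_nonneg p))
    simpa [this] using hq
  · have hn' : (0 : ℝ) < n := by exact_mod_cast hn
    refine le_of_mul_le_mul_left ?_ hn'
    nlinarith [sq_nonneg (p - n * y)]

lemma one_sub_prod_sq_le_of_recursion (hv0 : 0 ≤ v 0)
    (hv : ∀ t < n, (1 - x t) ^ 2 * v t + x t ^ 2 ≤ v (t + 1)) :
    (1 - ∏ t ∈ range n, (1 - x t)) ^ 2 ≤ n * v n := by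
  have hnonneg : ∀ m ≤ n, 0 ≤ v m := by
    intro m hm
    induction m with
    | zero => exact hv0
    | succ m ih =>
      have := ih (by omega)
      exact le_trans (by positivity) (hv m hm)
  suffices ∀ m ≤ n, (1 - ∏ t ∈ range m, (1 - x t)) ^ 2 ≤ m * v m from this n le_rfl
  intro m hm
  induction m with
  | zero => simp
  | succ m ih =>
    have hvm := hnonneg m (by omega)
    have hscale : ((1 - x m) * (1 - ∏ t ∈ range m, (1 - x t))) ^ 2
        ≤ m * ((1 - x m) ^ 2 * v m) := by
      rw [mul_pow, mul_left_comm]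
      gcongr
      exact ih (by omega)
    calc (1 - ∏ t ∈ range (m + 1), (1 - x t)) ^ 2
        = ((1 - x m) * (1 - ∏ t ∈ range m, (1 - x t)) + x m) ^ 2 := by
          rw [prod_range_succ]
          ring
      _ ≤ (m + 1) * ((1 - x m) ^ 2 * v m + x m ^ 2) :=
          sq_add_le_succ_mul (by positivity) hscale
      _ ≤ (m + 1 : ℕ) * v (m + 1) := by
          push_cast
          gcongr
          exact hv m hm

lemma sub_le_exp_neg_mul_sub {y y' c : ℝ} (hl : 0 ≤ l) (hlc : l ≤ c) (hch : c ≤ h)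
    (hh : 2 * h ≤ 1) (hC : 0 ≤ C) {z : ℝ} (hz : 0 ≤ z) (hy : y - h * C / 2 ≤ z)
    (hstep : y' ≤ (1 - 2 * c) * y + c ^ 2 * C) :
    y' - h * C / 2 ≤ Real.exp (-(2 * l)) * z := by
  have hnoise : c * c * C ≤ c * h * C := by
    have := hl.trans hlc
    gcongr
  calc y' - h * C / 2 ≤ (1 - 2 * c) * (y - h * C / 2) := by nlinarith
    _ ≤ (1 - 2 * c) * z := by
        gcongr
        linarith
    _ ≤ Real.exp (-(2 * l)) * z := by
        gcongr
        linarith [Real.one_sub_le_exp_neg (2 * l)]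

lemma le_exp_mul_add_of_recursion (hab : a ≤ b)
    (hu : ∀ t, a ≤ t → t < b → u (t + 1) ≤ (1 - 2 * g t) * u t + g t ^ 2 * C)
    (hg : ∀ t, a ≤ t → t < b → l ≤ g t ∧ g t ≤ h) (hl : 0 ≤ l) (hh0 : 0 ≤ h) (hh : 2 * h ≤ 1)
    (hC : 0 ≤ C) (hua : 0 ≤ u a) :
    u b ≤ Real.exp (-(2 * l * (b - a))) * u a + h * C / 2 := by
  suffices u b - h * C / 2 ≤ Real.exp (-(2 * l * (b - a))) * u a by linarith
  induction b, hab using Nat.le_induction with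
  | base =>
    have : 0 ≤ h * C / 2 := by positivity
    simpa using this
  | succ b hab ih =>
    have hgb := hg b hab b.lt_succ_self
    have hprev := ih (fun t hat htb => hu t hat (htb.trans b.lt_succ_self))
      fun t hat htb => hg t hat (htb.trans b.lt_succ_self)
    refine (sub_le_exp_neg_mul_sub hl hgb.1 hgb.2 hh hC (by positivity) hprev
      (hu b hab b.lt_succ_self)).trans_eq ?_
    rw [← mul_assoc, ← Real.exp_add]
    push_cast
    ring_nf

end ScalarRecursions

section GeometricSchedule

variable {u : ℕ → ℝ} {γ L C : ℝ} {n ℓ : ℕ}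

lemma le_of_geometric_stage (hL : 0 < L) (hγ0 : 0 ≤ γ) (hγ : 2 * γ ≤ 1) (hC : 0 ≤ C)
    (hu0 : ∀ t, 0 ≤ u t) (hn : (ℓ + 1) * L ≤ n)
    (hu : ∀ t < n, u (t + 1)
      ≤ (1 - 2 * (γ / 2 ^ ⌊t / L⌋₊)) * u t + (γ / 2 ^ ⌊t / L⌋₊) ^ 2 * C) :
    u n ≤ Real.exp (-(2 * (γ / 2 ^ ℓ) * (L - 1))) * u ⌈ℓ * L⌉₊ + γ / 2 ^ ℓ * C := by
  set first := ⌈ℓ * L⌉₊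
  set last := ⌈(ℓ + 1) * L⌉₊
  have hfirst : (first : ℝ) < ℓ * L + 1 := Nat.ceil_lt_add_one (by positivity)
  have hlast : (ℓ + 1) * L ≤ last := Nat.le_ceil _
  have hfirst_last : first ≤ last := Nat.ceil_mono (by gcongr; linarith)
  have hlast_n : last ≤ n := Nat.ceil_le.2 hn
  have hstep : γ / 2 ^ ℓ ≤ γ := div_le_self hγ0 (one_le_pow₀ one_le_two)
  have hfloor : ∀ t, first ≤ t → ℓ ≤ ⌊t / L⌋₊ := fun t ht =>
    Nat.le_floor ((le_div_iff₀ hL).2 (Nat.ceil_le.1 ht))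
  have hdecay : ∀ t, first ≤ t → γ / 2 ^ ⌊t / L⌋₊ ≤ γ / 2 ^ ℓ := fun t ht => by
    gcongr
    exacts [one_le_two, hfloor t ht]
  have hconst : ∀ t, first ≤ t → t < last → γ / 2 ^ ⌊t / L⌋₊ = γ / 2 ^ ℓ := fun t ht htl => by
    have : ⌊t / L⌋₊ < ℓ + 1 :=
      (Nat.floor_lt (by positivity)).2 (by
        rw [div_lt_iff₀ hL]
        exact_mod_cast Nat.lt_ceil.1 htl)
    rw [le_antisymm (Nat.lt_succ_iff.1 this) (hfloor t ht)]
  have hduring := le_exp_mul_add_of_recursion hfirst_last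
    (fun t _ htl => hu t (htl.trans_le hlast_n))
    (fun t ht htl => ⟨(hconst t ht htl).ge, (hconst t ht htl).le⟩) (by positivity) (by positivity)
    (by linarith) hC (hu0 _)
  have hafter := le_exp_mul_add_of_recursion hlast_n (fun t _ htn => hu t htn)
    (fun t ht _ => ⟨by positivity, hdecay t (hfirst_last.trans ht)⟩) le_rfl (by positivity)
    (by linarith) hC (hu0 _)
  have hlength : Real.exp (-(2 * (γ / 2 ^ ℓ) * (last - first))) * u first
      ≤ Real.exp (-(2 * (γ / 2 ^ ℓ) * (L - 1))) * u first := by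
    have := hu0 first
    have : L - 1 ≤ last - first := by linarith
    gcongr
  rw [mul_zero, zero_mul, neg_zero, Real.exp_zero, one_mul] at hafter
  linarith

lemma le_of_two_geometric_stages (hL : 0 < L) (hγ0 : 0 ≤ γ) (hγ : 2 * γ ≤ 1) (hC : 0 ≤ C)
    (hu0 : ∀ t, 0 ≤ u t) (hℓ : 1 ≤ ℓ) (hn : (ℓ + 1) * L ≤ n)
    (hu : ∀ t < n, u (t + 1)
      ≤ (1 - 2 * (γ / 2 ^ ⌊t / L⌋₊)) * u t + (γ / 2 ^ ⌊t / L⌋₊) ^ 2 * C) :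
    u n ≤ Real.exp (-(2 * (γ / 2 ^ ℓ) * (L - 1)))
      * (Real.exp (-(2 * γ * (L - 1))) * u 0 + γ * C) + γ / 2 ^ ℓ * C := by
  have hℓ' : (1 : ℝ) ≤ ℓ := by exact_mod_cast hℓ
  have hstart : ⌈ℓ * L⌉₊ ≤ n := Nat.ceil_le.2 (by linarith)
  have hfirst := le_of_geometric_stage (ℓ := 0) (n := ⌈ℓ * L⌉₊) hL hγ0 hγ hC hu0
    (le_trans (by push_cast; nlinarith) (Nat.le_ceil _)) fun t ht => hu t (ht.trans_le hstart)
  refine (le_of_geometric_stage hL hγ0 hγ hC hu0 hn hu).trans ?_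
  gcongr
  simpa using hfirst

end GeometricSchedule

section Asymptotics

lemma eventually_const_mul_log_sq_le_rpow (B : ℝ) {p : ℝ} (hp : 0 < p) :
    ∀ᶠ x : ℝ in atTop, B * Real.log x ^ 2 ≤ x ^ p := by
  have hlog := (isLittleO_log_rpow_rpow_atTop 2 hp).bound (c := (|B| + 1)⁻¹) (by positivity)
  filter_upwards [hlog, eventually_ge_atTop 1] with x hx hx1
  have := Real.log_nonneg hx1
  rw [Real.norm_of_nonneg (by positivity), Real.norm_of_nonneg (by positivity),
    Real.rpow_two, inv_mul_eq_div, le_div_iff₀ (by positivity)] at hx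
  nlinarith [le_abs_self B, sq_nonneg (Real.log x)]

lemma two_pow_floor_log_pred {x : ℝ} (hx : Real.exp 1 ≤ x) :
    x ^ Real.log 2 / 4 ≤ 2 ^ (⌊Real.log x⌋₊ - 1) ∧ (2 : ℝ) ^ (⌊Real.log x⌋₊ - 1) ≤ x ^ Real.log 2
      ∧ ((⌊Real.log x⌋₊ - 1 : ℕ) : ℝ) + 1 ≤ Real.log x := by
  have hx0 : 0 < x := (Real.exp_pos 1).trans_le hx
  have hlog : 1 ≤ Real.log x := (Real.le_log_iff_exp_le hx0).2 hx
  have hpow : x ^ Real.log 2 = 2 ^ Real.log x := by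
    rw [Real.rpow_def_of_pos hx0, Real.rpow_def_of_pos two_pos, mul_comm]
  have hfloor : 1 ≤ ⌊Real.log x⌋₊ := Nat.le_floor (by exact_mod_cast hlog)
  have hcast : ((⌊Real.log x⌋₊ - 1 : ℕ) : ℝ) = ⌊Real.log x⌋₊ - 1 := by
    rw [Nat.cast_sub hfloor, Nat.cast_one]
  have hle := Nat.floor_le (zero_le_one.trans hlog)
  rw [hpow, ← Real.rpow_natCast, hcast]
  refine ⟨?_, Real.rpow_le_rpow_of_exponent_le one_le_two (by linarith), by linarith⟩
  rw [show (4 : ℝ) = 2 ^ (2 : ℝ) by norm_num, ← Real.rpow_sub two_pos]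
  have hlt := Nat.lt_floor_add_one (Real.log x)
  exact Real.rpow_le_rpow_of_exponent_le one_le_two (by linarith)

lemma log_le_half {x : ℝ} (hx : 0 < x) : Real.log x ≤ x / 2 := by
  have h := Real.log_le_sub_one_of_pos (half_pos hx)
  rw [Real.log_div hx.ne' two_ne_zero] at h
  linarith [Real.log_two_lt_d9]

lemma log_le_mul_div_log_sub_one {a q x : ℝ} (ha : 0 ≤ a) (hx : 1 < x) (hq : 0 < q)
    (h : Real.log x ^ 2 * q ≤ a * x) : Real.log x ≤ 2 * (a / q) * (x / Real.log x - 1) := by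
  have hlog := Real.log_pos hx
  have hhalf := mul_le_mul_of_nonneg_left (log_le_half (zero_lt_one.trans hx)) ha
  rw [show 2 * (a / q) * (x / Real.log x - 1)
    = 2 * a * (x - Real.log x) / (q * Real.log x) by field_simp, le_div_iff₀ (by positivity)]
  linarith

-- The stage of index about `log x` has stepsize of order `x ^ (-log 2)`, and `1 / 2 < log 2 < 1`.
lemma eventually_exists_geometric_stage {a : ℝ} (ha : 0 < a) (C : ℝ) {c : ℝ} (hc : 0 < c) :
    ∀ᶠ x : ℝ in atTop, ∃ ℓ : ℕ, ℓ + 1 ≤ Real.log x ∧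
      Real.exp (-(2 * (a / 2 ^ ℓ) * (x / Real.log x - 1))) + C / 2 ^ ℓ
        ≤ c * x ^ (-(1 / 2) : ℝ) := by
  have hlog2 : 0 < 1 - Real.log 2 := by linarith [Real.log_two_lt_d9]
  have hlog2' : 0 < Real.log 2 - 1 / 2 := by linarith [Real.log_two_gt_d9]
  filter_upwards [eventually_const_mul_log_sq_le_rpow a⁻¹ hlog2,
    (tendsto_rpow_atTop hlog2').eventually_ge_atTop (8 * |C| / c),
    (tendsto_rpow_atTop (half_pos one_pos)).eventually_ge_atTop (2 / c),
    eventually_ge_atTop (Real.exp 1)] with x hlogsq hnoise hbias hx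
  obtain ⟨hlower, hupper, hstage⟩ := two_pow_floor_log_pred hx
  set ℓ := ⌊Real.log x⌋₊ - 1
  have hx1 : 1 < x := (Real.one_lt_exp_iff.2 one_pos).trans_le hx
  have hx0 : 0 < x := zero_lt_one.trans hx1
  have hexponent : Real.log x ≤ 2 * (a / 2 ^ ℓ) * (x / Real.log x - 1) := by
    have hcontract : Real.log x ^ 2 * 2 ^ ℓ ≤ a * x :=
      calc Real.log x ^ 2 * 2 ^ ℓ ≤ a * x ^ (1 - Real.log 2) * x ^ Real.log 2 := by
            rw [inv_mul_le_iff₀ ha] at hlogsq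
            gcongr
        _ = a * x := by rw [mul_assoc, ← Real.rpow_add hx0, sub_add_cancel, Real.rpow_one]
    exact log_le_mul_div_log_sub_one ha.le hx1 (by positivity) hcontract
  have hexp : Real.exp (-(2 * (a / 2 ^ ℓ) * (x / Real.log x - 1)))
      ≤ c / 2 * x ^ (-(1 / 2) : ℝ) :=
    calc Real.exp (-(2 * (a / 2 ^ ℓ) * (x / Real.log x - 1))) ≤ Real.exp (-Real.log x) := by gcongr
      _ = x ^ (-(1 / 2) : ℝ) * x ^ (-(1 / 2) : ℝ) := by
          rw [Real.exp_neg, Real.exp_log hx0, ← Real.rpow_add hx0, ← Real.rpow_neg_one]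
          norm_num
      _ ≤ c / 2 * x ^ (-(1 / 2) : ℝ) := by
          gcongr
          rw [Real.rpow_neg hx0.le, ← inv_div 2 c]
          exact inv_anti₀ (by positivity) hbias
  have hstep : C / 2 ^ ℓ ≤ c / 2 * x ^ (-(1 / 2) : ℝ) :=
    calc C / 2 ^ ℓ ≤ |C| / (x ^ Real.log 2 / 4) := by
          gcongr
          exact le_abs_self C
      _ = c / 2 * (8 * |C| / c) / x ^ Real.log 2 := by
          field_simp
          ring
      _ ≤ c / 2 * x ^ (Real.log 2 - 1 / 2) / x ^ Real.log 2 := by gcongr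
      _ = c / 2 * x ^ (-(1 / 2) : ℝ) := by
          rw [mul_div_assoc, ← Real.rpow_sub hx0]
          ring_nf
  exact ⟨ℓ, hstage, by linarith⟩

lemma exists_pos_forall_of_eventually_nhdsGT {p : ℝ → Prop} (h : ∀ᶠ ε in 𝓝[>] 0, p ε) :
    ∃ ε₀ > 0, ∀ ε, 0 < ε → ε < ε₀ → p ε := by
  obtain ⟨ε₀, hε₀, hsub⟩ := mem_nhdsGT_iff_exists_Ioo_subset.1 h
  exact ⟨ε₀, hε₀, fun ε h0 h1 => hsub ⟨h0, h1⟩⟩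

lemma eventually_exists_geometric_stage_of_mul_log_le {a₀ a₂ C c : ℝ} (ha₀ : 0 < a₀) (ha₂ : 0 < a₂)
    (hC : 0 ≤ C) (hc : 0 < c) :
    ∀ᶠ x : ℝ in atTop, ∀ γ m : ℝ, a₀ ≤ γ → γ ≤ 1 → a₂ * (x * Real.log x) ≤ m →
      ∃ ℓ : ℕ, ℓ + 1 ≤ Real.log m ∧
        Real.exp (-(2 * (γ / 2 ^ ℓ) * (m / Real.log m - 1))) + γ / 2 ^ ℓ * C
          ≤ c * x ^ (-(1 / 2) : ℝ) := by
  filter_upwards [eventually_forall_ge_atTop.2 (eventually_exists_geometric_stage ha₀ C hc),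
    Real.tendsto_log_atTop.eventually_ge_atTop a₂⁻¹, eventually_gt_atTop 1]
    with x hstage hlog hx γ m hγ hγ1 hm
  have hxm : x ≤ m := by nlinarith [(inv_le_iff_one_le_mul₀ ha₂).1 hlog]
  have hlogm : 0 < Real.log m := Real.log_pos (hx.trans_le hxm)
  have hlength : 1 ≤ m / Real.log m := by
    rw [one_le_div hlogm]
    linarith [log_le_half (x := m) (by linarith)]
  obtain ⟨ℓ, hℓ, hle⟩ := hstage m hxm
  refine ⟨ℓ, hℓ, ?_⟩
  calc Real.exp (-(2 * (γ / 2 ^ ℓ) * (m / Real.log m - 1))) + γ / 2 ^ ℓ * C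
      ≤ Real.exp (-(2 * (a₀ / 2 ^ ℓ) * (m / Real.log m - 1))) + 1 / 2 ^ ℓ * C := by gcongr
    _ = Real.exp (-(2 * (a₀ / 2 ^ ℓ) * (m / Real.log m - 1))) + C / 2 ^ ℓ := by
        rw [one_div_mul_eq_div]
    _ ≤ c * m ^ (-(1 / 2) : ℝ) := hle
    _ ≤ c * x ^ (-(1 / 2) : ℝ) := by
        gcongr c * ?_
        exact Real.rpow_le_rpow_of_nonpos (by linarith) hxm (by norm_num)

lemma eventually_log_le_of_mul_log_sq_le {a₁ a₃ : ℝ} (b₃ : ℝ) (ha₁ : 0 < a₁) (ha₃ : 0 < a₃)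
    (hκ : 2 ≤ a₁ * a₃) :
    ∀ᶠ x : ℝ in atTop, ∀ γ n : ℝ, a₁ * x⁻¹ ≤ γ → a₃ * (x * Real.log x ^ 2) ≤ n →
      n ≤ b₃ * (x * Real.log x ^ 2) →
      Real.log x ≤ Real.log n ∧ Real.log x ≤ 2 * γ * (n / Real.log n - 1) := by
  filter_upwards [eventually_const_mul_log_sq_le_rpow b₃ one_pos,
    Real.tendsto_log_atTop.eventually_ge_atTop (max 1 (4 / a₃)), eventually_gt_atTop 1]
    with x hpow hlog hx γ n hγ hle hge
  have hx0 : 0 < x := one_pos.trans hx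
  have hγ0 : 0 ≤ γ := le_trans (by positivity) hγ
  have hlog1 : 1 ≤ Real.log x := (le_max_left _ _).trans hlog
  have hlog4 : 4 ≤ a₃ * Real.log x := (div_le_iff₀' ha₃).1 ((le_max_right _ _).trans hlog)
  have hlength : x ≤ a₃ * (x * Real.log x) := by nlinarith
  have hn : x ≤ n := hlength.trans (le_trans (by gcongr; nlinarith) hle)
  have hlogn : Real.log x ≤ Real.log n := Real.log_le_log hx0 hn
  have hlogn2 : Real.log n ≤ 2 * Real.log x := by
    rw [Real.rpow_one] at hpow
    have hsq : n ≤ x ^ 2 := hge.trans (by nlinarith)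
    simpa using Real.log_le_log (hx0.trans_le hn) hsq
  have hstages : a₃ * (x * Real.log x) / 4 ≤ n / Real.log n - 1 := by
    have h : a₃ * (x * Real.log x) / 2 ≤ n / Real.log n := by
      rw [le_div_iff₀ (by linarith)]
      calc a₃ * (x * Real.log x) / 2 * Real.log n
          ≤ a₃ * (x * Real.log x) / 2 * (2 * Real.log x) := by gcongr
        _ = a₃ * (x * Real.log x ^ 2) := by ring
        _ ≤ n := hle
    nlinarith
  refine ⟨hlogn, ?_⟩
  calc Real.log x ≤ a₁ * a₃ * Real.log x / 2 := by nlinarith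
    _ = 2 * (a₁ * x⁻¹) * (a₃ * (x * Real.log x) / 4) := by field_simp; ring
    _ ≤ 2 * γ * (n / Real.log n - 1) := by gcongr

lemma eventually_exists_two_geometric_stages {a₁ a₃ : ℝ} (b₁ b₃ : ℝ) {C c : ℝ} (ha₁ : 0 < a₁)
    (ha₃ : 0 < a₃) (hκ : 2 ≤ a₁ * a₃) (hC : 0 ≤ C) (hc : 0 < c) :
    ∀ᶠ x : ℝ in atTop, ∀ γ n : ℝ, a₁ * x⁻¹ ≤ γ → γ ≤ b₁ * x⁻¹ → a₃ * (x * Real.log x ^ 2) ≤ n →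
      n ≤ b₃ * (x * Real.log x ^ 2) →
      ∃ ℓ : ℕ, 1 ≤ ℓ ∧ ℓ + 1 ≤ Real.log n ∧
        Real.exp (-(2 * (γ / 2 ^ ℓ) * (n / Real.log n - 1)))
          * (Real.exp (-(2 * γ * (n / Real.log n - 1))) + γ * C) + γ / 2 ^ ℓ * C ≤ c * x⁻¹ := by
  obtain ⟨ℓ, hℓpow, hℓ⟩ : ∃ ℓ : ℕ, b₁ * C / (c / 2) ≤ 2 ^ ℓ ∧ 1 ≤ ℓ :=
    (((tendsto_pow_atTop_atTop_of_one_lt one_lt_two).eventually_ge_atTop _).and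
      (eventually_ge_atTop 1)).exists
  have hexp : Tendsto (fun x => Real.exp (-(Real.log x / 2 ^ ℓ)) * (1 + b₁ * C)) atTop (𝓝 0) := by
    simpa using (Real.tendsto_exp_neg_atTop_nhds_zero.comp
      (Real.tendsto_log_atTop.atTop_div_const (by positivity))).mul_const (1 + b₁ * C)
  filter_upwards [eventually_log_le_of_mul_log_sq_le b₃ ha₁ ha₃ hκ,
    hexp.eventually_le_const (half_pos hc), Real.tendsto_log_atTop.eventually_ge_atTop (ℓ + 1 : ℝ),
    eventually_gt_atTop 0] with x hrate hlate hlog hx γ n hγ hγ' hle hge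
  obtain ⟨hlogn, hcontract⟩ := hrate γ n hγ hle hge
  refine ⟨ℓ, hℓ, hlog.trans hlogn, ?_⟩
  have hfirst : Real.exp (-(2 * γ * (n / Real.log n - 1))) ≤ x⁻¹ := by
    rw [← Real.exp_log (inv_pos.2 hx), Real.log_inv]
    gcongr
  have hsecond : Real.log x / 2 ^ ℓ ≤ 2 * (γ / 2 ^ ℓ) * (n / Real.log n - 1) := by
    rw [show 2 * (γ / 2 ^ ℓ) * (n / Real.log n - 1)
      = 2 * γ * (n / Real.log n - 1) / 2 ^ ℓ by ring]
    gcongr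
  have hnoise : b₁ * C / 2 ^ ℓ ≤ c / 2 := by
    rwa [div_le_iff₀' (by positivity), ← div_le_iff₀ (half_pos hc)]
  calc _ ≤ Real.exp (-(Real.log x / 2 ^ ℓ)) * (x⁻¹ + b₁ * x⁻¹ * C) + b₁ * x⁻¹ / 2 ^ ℓ * C := by
        have : 0 ≤ γ := le_trans (by positivity) hγ
        gcongr
    _ = (Real.exp (-(Real.log x / 2 ^ ℓ)) * (1 + b₁ * C) + b₁ * C / 2 ^ ℓ) * x⁻¹ := by ring
    _ ≤ c * x⁻¹ := by
        gcongr
        linarith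

lemma eventually_mul_sq_mul_le_rpow (b₁ b₃ : ℝ) {C c : ℝ} (hC : 0 ≤ C) (hc : 0 < c) :
    ∀ᶠ x : ℝ in atTop, ∀ γ n : ℝ, 0 ≤ γ → γ ≤ b₁ * x⁻¹ → 0 ≤ n → n ≤ b₃ * (x * Real.log x ^ 2) →
      n * γ ^ 2 * C ≤ c * x ^ (-(1 / 2) : ℝ) := by
  filter_upwards [eventually_const_mul_log_sq_le_rpow (b₃ * b₁ ^ 2 * C / c) (half_pos one_pos),
    eventually_gt_atTop 0] with x hpow hx γ n hγ hγ' hn hn'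
  calc n * γ ^ 2 * C ≤ b₃ * (x * Real.log x ^ 2) * (b₁ * x⁻¹) ^ 2 * C := by
        have := hn.trans hn'
        gcongr
    _ = c * (b₃ * b₁ ^ 2 * C / c * Real.log x ^ 2 * x⁻¹) := by field_simp
    _ ≤ c * (x ^ (1 / 2 : ℝ) * x⁻¹) := by gcongr
    _ = c * x ^ (-(1 / 2) : ℝ) := by
        rw [← div_eq_mul_inv, ← Real.rpow_sub_one hx.ne']
        norm_num

end Asymptotics

section StepSize

variable {γ₀ γM : ℝ} {M N t : ℕ}

lemma stepSize_source (h : t < M) :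
    stepSize γ₀ γM M N t = γ₀ / 2 ^ ⌊(t : ℝ) / (M / Real.log M)⌋₊ := if_pos h

lemma stepSize_target (n : ℕ) :
    stepSize γ₀ γM M N (M + n) = γM / 2 ^ ⌊(n : ℝ) / (N / Real.log N)⌋₊ := by
  simp [stepSize]

lemma stepSize_mem_Icc {b : ℝ} (hγ₀ : γ₀ ∈ Set.Icc 0 b) (hγM : γM ∈ Set.Icc 0 b) (t : ℕ) :
    stepSize γ₀ γM M N t ∈ Set.Icc 0 b := by
  have hhalve {c : ℝ} (hc : c ∈ Set.Icc 0 b) (k : ℕ) : c / 2 ^ k ∈ Set.Icc 0 b :=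
    ⟨div_nonneg hc.1 (by positivity), (div_le_self hc.1 (one_le_pow₀ one_le_two)).trans hc.2⟩
  unfold stepSize
  split_ifs
  exacts [hhalve hγ₀ _, hhalve hγM _]

lemma stepSize_target_le (hγM : 0 ≤ γM) (n : ℕ) : stepSize γ₀ γM M N (M + n) ≤ γM := by
  rw [stepSize_target]
  exact div_le_self hγM (one_le_pow₀ one_le_two)

lemma stepSize_source_le (hγ₀ : 0 ≤ γ₀) (h : t < M) : stepSize γ₀ γM M N t ≤ γ₀ := by
  rw [stepSize_source h]
  exact div_le_self hγ₀ (one_le_pow₀ one_le_two)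

lemma stageLength_pos {ℓ : ℕ} (h : ℓ + 1 ≤ Real.log M) : 0 < M / Real.log M := by
  have hlog : 0 < Real.log M := ℓ.cast_add_one_pos.trans_le h
  refine div_pos (Nat.cast_pos.2 (Nat.pos_of_ne_zero ?_)) hlog
  rintro rfl
  simp at hlog

lemma add_one_mul_stageLength_le {ℓ : ℕ} (h : ℓ + 1 ≤ Real.log M) :
    (ℓ + 1) * (M / Real.log M) ≤ M := by
  rw [← mul_div_assoc, div_le_iff₀' (ℓ.cast_add_one_pos.trans_le h)]
  gcongr

end StepSize

namespace ShiftInstance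

section Spectra

variable {E : Type*} [NormedAddCommGroup E] [InnerProductSpace ℝ E] [MeasurableSpace E]
  {ε : ℝ} (I : ShiftInstance ε E)

lemma rpow_half_sq (h0 : 0 < ε) : (ε ^ (1 / 2 : ℝ)) ^ 2 = ε := by
  rw [← Real.rpow_natCast, ← Real.rpow_mul h0.le]
  norm_num

lemma one_le_rpow_neg_half (h0 : 0 < ε) (h1 : ε < 1) : 1 ≤ ε ^ (-(1 / 2) : ℝ) :=
  Real.one_le_rpow_of_pos_of_le_one_of_nonpos h0 h1.le (by norm_num)

lemma rpow_neg_half_le_K (h0 : 0 < ε) (h1 : ε < 1) : ε ^ (-(1 / 2) : ℝ) ≤ I.K := by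
  linarith [(abs_lt.1 I.copies).1, one_le_rpow_neg_half h0 h1]

lemma one_ne_zero_index (h0 : 0 < ε) (h1 : ε < 1) : (1 : Fin (I.K + 1)) ≠ 0 := by
  have hK : (0 : ℝ) < I.K :=
    zero_lt_one.trans_le ((one_le_rpow_neg_half h0 h1).trans (I.rpow_neg_half_le_K h0 h1))
  rw [Ne, Fin.one_eq_zero_iff]
  have := Nat.cast_pos.1 hK
  omega

lemma K_mul_rpow_half_le (h0 : 0 < ε) (h1 : ε < 1) : I.K * ε ^ (1 / 2 : ℝ) ≤ 3 := by
  have hr1 : ε ^ (1 / 2 : ℝ) ≤ 1 := Real.rpow_le_one h0.le h1.le (by norm_num)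
  have hmul : ε ^ (-(1 / 2) : ℝ) * ε ^ (1 / 2 : ℝ) = 1 := by
    rw [← Real.rpow_add h0, neg_add_cancel, Real.rpow_zero]
  have hK := mul_le_mul_of_nonneg_right (abs_lt.1 I.copies).2.le (Real.rpow_nonneg h0.le (1 / 2))
  linarith

variable {K : ℕ} {i : Fin (K + 1)}

lemma targetSpectrum_zero : targetSpectrum ε K 0 = 1 := if_pos rfl

lemma targetSpectrum_of_ne_zero (h : i ≠ 0) : targetSpectrum ε K i = ε ^ (1 / 2 : ℝ) := if_neg h

lemma sourceSpectrum_zero : sourceSpectrum ε K 0 = ε ^ 2 := if_pos rfl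

lemma sourceSpectrum_of_ne (h : i ≠ 0) (h' : i ≠ 1) : sourceSpectrum ε K i = 0 := by
  simp [sourceSpectrum, h, h']

lemma sourceSpectrum_one (h0 : 0 < ε) (h1 : ε < 1) : sourceSpectrum ε I.K 1 = 1 := by
  simp [sourceSpectrum, I.one_ne_zero_index h0 h1]

lemma targetSpectrum_mem_Icc (h0 : 0 < ε) (h1 : ε < 1) : targetSpectrum ε K i ∈ Set.Icc 0 1 := by
  unfold targetSpectrum
  split_ifs
  exacts [⟨zero_le_one, le_rfl⟩, ⟨by positivity, Real.rpow_le_one h0.le h1.le (by norm_num)⟩]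

lemma sourceSpectrum_mem_Icc (h0 : 0 < ε) (h1 : ε < 1) : sourceSpectrum ε K i ∈ Set.Icc 0 1 := by
  unfold sourceSpectrum
  split_ifs
  exacts [⟨sq_nonneg ε, pow_le_one₀ h0.le h1.le⟩, ⟨zero_le_one, le_rfl⟩, ⟨le_rfl, zero_le_one⟩]

lemma sum_targetSpectrum_mul (f : Fin (K + 1) → ℝ) :
    ∑ i, targetSpectrum ε K i * f i = f 0 + ε ^ (1 / 2 : ℝ) * ∑ i : Fin K, f i.succ := by
  rw [Fin.sum_univ_succ, mul_sum, targetSpectrum_zero, one_mul]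
  simp only [targetSpectrum_of_ne_zero (Fin.succ_ne_zero _)]

lemma sum_sourceSpectrum_mul (h0 : 0 < ε) (h1 : ε < 1) (f : Fin (I.K + 1) → ℝ) :
    ∑ i, sourceSpectrum ε I.K i * f i = ε ^ 2 * f 0 + f 1 := by
  rw [sum_eq_add_of_mem 0 1 (mem_univ _) (mem_univ _) (I.one_ne_zero_index h0 h1).symm,
    sourceSpectrum_zero, I.sourceSpectrum_one h0 h1, one_mul]
  rintro i - ⟨hi0, hi1⟩
  rw [sourceSpectrum_of_ne hi0 hi1, zero_mul]

lemma traceH_eq : I.traceH = 1 + I.K * ε ^ (1 / 2 : ℝ) := by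
  have h := sum_targetSpectrum_mul (ε := ε) (K := I.K) fun _ => 1
  simp only [mul_one, sum_const, card_univ, Fintype.card_fin, nsmul_eq_mul] at h
  rw [traceH, h, mul_comm]

lemma traceG_eq (h0 : 0 < ε) (h1 : ε < 1) : I.traceG = ε ^ 2 + 1 := by
  simpa [traceG] using I.sum_sourceSpectrum_mul h0 h1 fun _ => 1

lemma traceH_mem_Icc (h0 : 0 < ε) (h1 : ε < 1) : I.traceH ∈ Set.Icc 1 4 := by
  have : 0 ≤ I.K * ε ^ (1 / 2 : ℝ) := by positivity
  rw [I.traceH_eq]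
  constructor <;> linarith [I.K_mul_rpow_half_le h0 h1]

lemma traceG_mem_Icc (h0 : 0 < ε) (h1 : ε < 1) : I.traceG ∈ Set.Icc 1 4 := by
  rw [I.traceG_eq h0 h1]
  constructor <;> nlinarith

lemma inner_e_wStar (h0 : 0 < ε) (h1 : ε < 1) (i : Fin (I.K + 1)) :
    ⟪I.e i, I.wStar⟫ = if i = 0 ∨ i = 1 then 1 else 0 := by
  have hne := I.one_ne_zero_index h0 h1
  rw [wStar, inner_add_right, orthonormal_iff_ite.1 I.orthonormal,
    orthonormal_iff_ite.1 I.orthonormal]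
  by_cases h : i = 0
  · simp [h, hne.symm]
  · simp [h]

lemma inner_e_zero_wStar (h0 : 0 < ε) (h1 : ε < 1) : ⟪I.e 0, I.wStar⟫ = 1 := by
  simp [I.inner_e_wStar h0 h1]

lemma inner_e_one_wStar (h0 : 0 < ε) (h1 : ε < 1) : ⟪I.e 1, I.wStar⟫ = 1 := by
  simp [I.inner_e_wStar h0 h1]

lemma inner_e_wStar_of_ne (h0 : 0 < ε) (h1 : ε < 1) {i : Fin (I.K + 1)} (hi0 : i ≠ 0)
    (hi1 : i ≠ 1) : ⟪I.e i, I.wStar⟫ = 0 := by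
  simp [I.inner_e_wStar h0 h1, hi0, hi1]

lemma normSqOp_G_wStar (h0 : 0 < ε) (h1 : ε < 1) : normSqOp I.G I.wStar = ε ^ 2 + 1 := by
  rw [normSqOp, G, inner_self_diagOp, I.sum_sourceSpectrum_mul h0 h1,
    I.inner_e_zero_wStar h0 h1, I.inner_e_one_wStar h0 h1, one_pow, mul_one]

lemma normSqOp_H_wStar (h0 : 0 < ε) (h1 : ε < 1) :
    normSqOp I.H I.wStar = 1 + ε ^ (1 / 2 : ℝ) := by
  have hne := I.one_ne_zero_index h0 h1
  rw [normSqOp, H, inner_self_diagOp, sum_eq_add_of_mem 0 1 (mem_univ _) (mem_univ _) hne.symm,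
    targetSpectrum_zero, targetSpectrum_of_ne_zero hne, I.inner_e_zero_wStar h0 h1,
    I.inner_e_one_wStar h0 h1, one_pow, mul_one, mul_one]
  rintro i - ⟨hi0, hi1⟩
  rw [I.inner_e_wStar_of_ne h0 h1 hi0 hi1, zero_pow two_ne_zero, mul_zero]

lemma normSqOp_G_wStar_mem_Icc (h0 : 0 < ε) (h1 : ε < 1) :
    normSqOp I.G I.wStar ∈ Set.Icc 1 4 := by
  rw [I.normSqOp_G_wStar h0 h1]
  constructor <;> nlinarith

lemma normSqOp_H_wStar_mem_Icc (h0 : 0 < ε) (h1 : ε < 1) :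
    normSqOp I.H I.wStar ∈ Set.Icc 1 4 := by
  have hr : 0 < ε ^ (1 / 2 : ℝ) := by positivity
  have hr1 : ε ^ (1 / 2 : ℝ) ≤ 1 := Real.rpow_le_one h0.le h1.le (by norm_num)
  rw [I.normSqOp_H_wStar h0 h1]
  constructor <;> linarith

lemma one_le_norm_G (h0 : 0 < ε) (h1 : ε < 1) : 1 ≤ ‖I.G‖ := by
  have hinner : ⟪I.e 1, I.G (I.e 1)⟫ = 1 := by
    rw [G, inner_orthonormal_diagOp I.orthonormal, I.sourceSpectrum_one h0 h1,
      real_inner_self_eq_norm_sq, I.orthonormal.1, one_pow, one_mul]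
  calc (1 : ℝ) = ⟪I.e 1, I.G (I.e 1)⟫ := hinner.symm
    _ ≤ ‖I.e 1‖ * (‖I.G‖ * ‖I.e 1‖) :=
        (real_inner_le_norm _ _).trans (by gcongr; exact I.G.le_opNorm _)
    _ = ‖I.G‖ := by rw [I.orthonormal.1, one_mul, mul_one]

end Spectra

section Covariates

variable {E : Type*} [NormedAddCommGroup E] [InnerProductSpace ℝ E] [MeasurableSpace E]
  {ε : ℝ} (I : ShiftInstance ε E) {M t : ℕ} {i : Fin (I.K + 1)}

/-- The law of the `t`-th covariate. -/
noncomputable def covariateLaw (M t : ℕ) : Measure E := if t < M then I.PS else I.PT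

/-- The eigenvalues, along the system `e`, of the second moment of the `t`-th covariate. -/
noncomputable def covariateSpectrum (M t : ℕ) : Fin (I.K + 1) → ℝ :=
  if t < M then sourceSpectrum ε I.K else targetSpectrum ε I.K

instance covariateLaw_isProbabilityMeasure : IsProbabilityMeasure (I.covariateLaw M t) := by
  unfold covariateLaw
  split_ifs <;> infer_instance

lemma covariateSpectrum_source (h : t < M) : I.covariateSpectrum M t = sourceSpectrum ε I.K :=
  if_pos h

lemma covariateSpectrum_target (h : M ≤ t) : I.covariateSpectrum M t = targetSpectrum ε I.K :=
  if_neg h.not_gt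

lemma hasSecondMoment_covariateLaw :
    HasSecondMoment (I.covariateLaw M t) (diagOp I.e (I.covariateSpectrum M t)) := by
  unfold covariateLaw covariateSpectrum
  split_ifs
  exacts [I.secondMomentS, I.secondMomentT]

lemma fourthMomentUpper_covariateLaw {α : ℝ} (hα : I.FourthMoment α) :
    FourthMomentUpper α (I.covariateLaw M t) I.e (I.covariateSpectrum M t) := by
  unfold covariateLaw covariateSpectrum
  split_ifs
  exacts [hα.1, hα.2]

lemma covariateSpectrum_mem_Icc (h0 : 0 < ε) (h1 : ε < 1) :
    I.covariateSpectrum M t i ∈ Set.Icc 0 1 := by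
  unfold covariateSpectrum
  split_ifs
  exacts [sourceSpectrum_mem_Icc h0 h1, targetSpectrum_mem_Icc h0 h1]

lemma sum_covariateSpectrum_le (h0 : 0 < ε) (h1 : ε < 1) :
    ∑ i, I.covariateSpectrum M t i ≤ 4 := by
  unfold covariateSpectrum
  split_ifs
  exacts [(I.traceG_mem_Icc h0 h1).2, (I.traceH_mem_Icc h0 h1).2]

lemma dataMeasure_eq : I.dataMeasure M = regressionMeasure (I.covariateLaw M) I.wStar := by
  unfold dataMeasure regressionMeasure
  congr with t : 1
  unfold datumLaw covariateLaw
  split_ifs <;> rfl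

variable [BorelSpace E] [SecondCountableTopology E]

lemma memLp_covariateLaw : MemLp id 4 (I.covariateLaw M t) := by
  unfold covariateLaw
  split_ifs
  exacts [memLp_four_of_integrable_norm_pow I.fourthMomentS,
    memLp_four_of_integrable_norm_pow I.fourthMomentT]

end Covariates

section CoordError

variable {E : Type*} [NormedAddCommGroup E] [InnerProductSpace ℝ E] [MeasurableSpace E]
  {ε : ℝ} (I : ShiftInstance ε E)

/-- The expected target excess risk of the `n`-th iterate of SGD with an arbitrary stepsize
schedule `γ`, run on `M` source data followed by target data. -/
noncomputable def iterateRisk (γ : ℕ → ℝ) (M n : ℕ) : ℝ :=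
  ∫ z, I.excessRisk (sgd γ z n) ∂I.dataMeasure M

/-- The mean square error along `e i` of the `t`-th iterate of SGD, run on `M` source data followed
by target data. -/
noncomputable def coordError (γ : ℕ → ℝ) (M : ℕ) (i : Fin (I.K + 1)) (t : ℕ) : ℝ :=
  directionalError (I.covariateLaw M) γ I.wStar (I.e i) t

variable {γ : ℕ → ℝ} {M n t : ℕ} {i : Fin (I.K + 1)} {α : ℝ}

lemma coordError_nonneg : 0 ≤ I.coordError γ M i t := directionalError_nonneg

variable [BorelSpace E] [SecondCountableTopology E]

lemma coordError_initial : I.coordError γ M i 0 = ⟪I.e i, I.wStar⟫ ^ 2 := directionalError_zero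

lemma excessRisk_eq (w : E) :
    I.excessRisk w = 1 / 2 * ∑ i, targetSpectrum ε I.K i * ⟪I.e i, w - I.wStar⟫ ^ 2 := by
  rw [excessRisk, risk_sub_risk ((memLp_four_of_integrable_norm_pow I.fourthMomentT).mono_exponent
    (by norm_num)) I.secondMomentT, inner_self_diagOp]

lemma integrable_sq_inner_e_sgd :
    Integrable (fun z => ⟪I.e i, sgd γ z n - I.wStar⟫ ^ 2) (I.dataMeasure M) := by
  rw [dataMeasure_eq]
  exact integrable_sq_inner_sgd_sub fun _ => I.memLp_covariateLaw

lemma integrable_excessRisk_sgd :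
    Integrable (fun z => I.excessRisk (sgd γ z n)) (I.dataMeasure M) := by
  simp only [excessRisk_eq]
  exact (integrable_finsetSum _ fun i _ => I.integrable_sq_inner_e_sgd.const_mul _).const_mul _

lemma iterateRisk_eq_sum :
    I.iterateRisk γ M n = 1 / 2 * ∑ i, targetSpectrum ε I.K i * I.coordError γ M i n := by
  simp only [iterateRisk, excessRisk_eq]
  rw [integral_const_mul, integral_finsetSum _ fun i _ => I.integrable_sq_inner_e_sgd.const_mul _]
  simp only [integral_const_mul, dataMeasure_eq]
  rfl

lemma targetSpectrum_mul_coordError_le (h0 : 0 < ε) (h1 : ε < 1) :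
    targetSpectrum ε I.K i * I.coordError γ M i n ≤ 2 * I.iterateRisk γ M n := by
  rw [iterateRisk_eq_sum]
  linarith [single_le_sum (f := fun i => targetSpectrum ε I.K i * I.coordError γ M i n)
    (fun j _ => mul_nonneg (targetSpectrum_mem_Icc h0 h1).1 I.coordError_nonneg) (mem_univ i)]

lemma le_coordError_succ (γ : ℕ → ℝ) (M t : ℕ) (i : Fin (I.K + 1)) :
    (1 - γ t * I.covariateSpectrum M t i) ^ 2 * I.coordError γ M i t
      + γ t ^ 2 * I.covariateSpectrum M t i ≤ I.coordError γ M i (t + 1) := by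
  have h := le_directionalError_succ (P := I.covariateLaw M) (γ := γ) (w := I.wStar) (u := I.e i)
    (t := t) (fun _ => I.memLp_covariateLaw) I.hasSecondMoment_covariateLaw
    (inner_orthonormal_diagOp (s := I.covariateSpectrum M t) I.orthonormal i)
  rwa [inner_orthonormal_diagOp I.orthonormal, real_inner_self_eq_norm_sq, I.orthonormal.1, one_pow,
    mul_one] at h

lemma coordError_succ_le (hα : I.FourthMoment α) (γ : ℕ → ℝ) (M t : ℕ)
    (i : Fin (I.K + 1)) :
    I.coordError γ M i (t + 1)
      ≤ (1 - 2 * γ t * I.covariateSpectrum M t i) * I.coordError γ M i t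
        + γ t ^ 2 * I.covariateSpectrum M t i *
          (1 + α * ∑ j, I.covariateSpectrum M t j * I.coordError γ M j t) :=
  directionalError_succ_le (fun _ => I.memLp_covariateLaw) I.orthonormal
    I.hasSecondMoment_covariateLaw (I.fourthMomentUpper_covariateLaw hα) i

lemma one_le_of_fourthMoment (hα : I.FourthMoment α) : 1 ≤ α :=
  one_le_of_fourthMomentUpper (memLp_four_of_integrable_norm_pow I.fourthMomentT) I.orthonormal
    I.secondMomentT hα.2 targetSpectrum_zero

end CoordError

section LowerBounds

variable {E : Type*} [NormedAddCommGroup E] [InnerProductSpace ℝ E] [MeasurableSpace E]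
  [BorelSpace E] [SecondCountableTopology E] {ε : ℝ} (I : ShiftInstance ε E) {γ : ℕ → ℝ} {M N : ℕ}

lemma prod_sq_le_coordError (h0 : 0 < ε) (h1 : ε < 1) {i : Fin (I.K + 1)} (hi : i = 0 ∨ i = 1)
    (n : ℕ) :
    (∏ t ∈ range n, (1 - γ t * I.covariateSpectrum M t i)) ^ 2 ≤ I.coordError γ M i n := by
  have hinit : I.coordError γ M i 0 = 1 := by
    rw [coordError_initial, I.inner_e_wStar h0 h1, if_pos hi, one_pow]
  have h := mul_prod_sq_le_of_recursion (v := I.coordError γ M i) (n := n)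
    fun t _ => le_of_add_le_of_nonneg_left (I.le_coordError_succ γ M t i)
      (mul_nonneg (sq_nonneg _) (I.covariateSpectrum_mem_Icc h0 h1).1)
  rwa [hinit, one_mul] at h

lemma one_sub_prod_sq_le_mul_coordError (h0 : 0 < ε) {i : Fin (I.K + 1)} (hi : i ≠ 0) :
    (1 - ∏ t ∈ range N, (1 - γ t * ε ^ (1 / 2 : ℝ))) ^ 2
      ≤ N * (ε ^ (1 / 2 : ℝ) * I.coordError γ 0 i N) := by
  have hr : 0 ≤ ε ^ (1 / 2 : ℝ) := by positivity
  refine one_sub_prod_sq_le_of_recursion (v := fun t => ε ^ (1 / 2 : ℝ) * I.coordError γ 0 i t)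
    (mul_nonneg hr I.coordError_nonneg) fun t _ => ?_
  have h := I.le_coordError_succ γ 0 t i
  rw [I.covariateSpectrum_target t.zero_le, targetSpectrum_of_ne_zero hi] at h
  linarith [mul_le_mul_of_nonneg_left h hr]

lemma prod_sq_lt_of_iterateRisk_lt (h0 : 0 < ε) (h1 : ε < 1) (h : I.iterateRisk γ 0 N < ε) :
    (∏ t ∈ range N, (1 - γ t * ε ^ (1 / 2 : ℝ))) ^ 2 < 2 * ε ^ (1 / 2 : ℝ) := by
  have hr : 0 < ε ^ (1 / 2 : ℝ) := by positivity
  have hne := I.one_ne_zero_index h0 h1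
  have hprod := I.prod_sq_le_coordError (γ := γ) (M := 0) h0 h1 (Or.inr rfl) N
  have hrisk := I.targetSpectrum_mul_coordError_le (γ := γ) (M := 0) (n := N) (i := 1) h0 h1
  simp only [I.covariateSpectrum_target (Nat.zero_le _), targetSpectrum_of_ne_zero hne]
    at hprod hrisk
  refine hprod.trans_lt (lt_of_mul_lt_mul_left ?_ hr.le)
  linarith [rpow_half_sq h0]

theorem le_samples_of_supervised (h0 : 0 < ε) (h1 : ε < 1 / 64) (h : I.iterateRisk γ 0 N < ε) :
    1 / 8 * ε ^ (-(3 / 2) : ℝ) ≤ N := by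
  have hε1 : ε < 1 := by linarith
  have hr : 0 < ε ^ (1 / 2 : ℝ) := by positivity
  have hr8 : ε ^ (1 / 2 : ℝ) < 1 / 8 := by nlinarith [rpow_half_sq h0]
  set P := ∏ t ∈ range N, (1 - γ t * ε ^ (1 / 2 : ℝ))
  have hPsq : P ^ 2 < 2 * ε ^ (1 / 2 : ℝ) := I.prod_sq_lt_of_iterateRisk_lt h0 hε1 h
  have hbias : 1 / 4 ≤ (1 - P) ^ 2 := by nlinarith
  have hcoord (i : Fin I.K) : 1 / 4 ≤ N * (ε ^ (1 / 2 : ℝ) * I.coordError γ 0 i.succ N) :=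
    hbias.trans (I.one_sub_prod_sq_le_mul_coordError h0 i.succ_ne_zero)
  have hsum : I.K * (1 / 4 : ℝ)
      ≤ N * (ε ^ (1 / 2 : ℝ) * ∑ i : Fin I.K, I.coordError γ 0 i.succ N) := by
    simpa [mul_sum] using sum_le_sum fun i (_ : i ∈ univ) => hcoord i
  have hrisk : ε ^ (1 / 2 : ℝ) * ∑ i : Fin I.K, I.coordError γ 0 i.succ N ≤ 2 * ε := by
    rw [iterateRisk_eq_sum, sum_targetSpectrum_mul] at h
    linarith [I.coordError_nonneg (γ := γ) (M := 0) (i := 0) (t := N)]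
  have hK := I.rpow_neg_half_le_K h0 hε1
  have hpow : ε ^ (-(1 / 2) : ℝ) = ε ^ (-(3 / 2) : ℝ) * ε := by
    rw [← Real.rpow_add_one h0.ne']
    norm_num
  refine le_of_mul_le_mul_right ?_ h0
  linarith [mul_le_mul_of_nonneg_left hrisk N.cast_nonneg]

theorem le_samples_of_pretraining (h0 : 0 < ε) (h1 : ε < 1 / 8) (hγ : ∀ t < M, γ t ≤ 1 / ‖I.G‖)
    (h : I.iterateRisk γ M M < ε) : 1 / 2 * ε ^ (-2 : ℝ) ≤ M := by
  have hε1 : ε < 1 := by linarith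
  have hfactor (t : ℕ) (ht : t ∈ range M) : 1 + -ε ^ 2 ≤ 1 - γ t * I.covariateSpectrum M t 0 := by
    have ht := mem_range.1 ht
    have hγt : γ t ≤ 1 := (hγ t ht).trans (div_le_one_of_le₀ (I.one_le_norm_G h0 hε1)
      (norm_nonneg _))
    rw [I.covariateSpectrum_source ht, sourceSpectrum_zero]
    linarith [mul_le_mul_of_nonneg_right hγt (sq_nonneg ε)]
  have hbernoulli : 1 + M * -ε ^ 2 ≤ ∏ t ∈ range M, (1 - γ t * I.covariateSpectrum M t 0) :=
    calc 1 + M * -ε ^ 2 ≤ (1 + -ε ^ 2) ^ M := one_add_mul_le_pow (by nlinarith) M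
      _ = ∏ _t ∈ range M, (1 + -ε ^ 2) := by rw [prod_const, card_range]
      _ ≤ _ := prod_le_prod (fun _ _ => by nlinarith) hfactor
  have hprod := I.prod_sq_le_coordError (γ := γ) (M := M) h0 hε1 (Or.inl rfl) M
  have hrisk := I.targetSpectrum_mul_coordError_le (γ := γ) (M := M) (n := M) (i := 0) h0 hε1
  rw [targetSpectrum_zero] at hrisk
  have hM : 1 / 2 ≤ M * ε ^ 2 := by nlinarith
  rw [Real.rpow_neg h0.le, Real.rpow_ofNat, ← div_eq_mul_inv]
  exact (div_le_iff₀ (by positivity)).2 hM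

end LowerBounds

section Stability

variable {E : Type*} [NormedAddCommGroup E] [InnerProductSpace ℝ E] [MeasurableSpace E]
  [BorelSpace E] [SecondCountableTopology E] {ε : ℝ} (I : ShiftInstance ε E) {γ : ℕ → ℝ} {α : ℝ}
  {M n t : ℕ} {i : Fin (I.K + 1)}

lemma coordError_initial_le_one (h0 : 0 < ε) (h1 : ε < 1) : I.coordError γ M i 0 ≤ 1 := by
  rw [coordError_initial, I.inner_e_wStar h0 h1]
  split_ifs <;> norm_num

lemma coordError_succ_le_of_le_one (hα : I.FourthMoment α) (h0 : 0 < ε) (h1 : ε < 1)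
    (ht : ∀ j, I.coordError γ M j t ≤ 1) (i : Fin (I.K + 1)) :
    I.coordError γ M i (t + 1)
      ≤ (1 - 2 * γ t * I.covariateSpectrum M t i) * I.coordError γ M i t
        + γ t ^ 2 * I.covariateSpectrum M t i * (1 + 4 * α) := by
  have hs (j : Fin (I.K + 1)) := (I.covariateSpectrum_mem_Icc (M := M) (t := t) (i := j) h0 h1).1
  have hα0 : 0 ≤ α := zero_le_one.trans (I.one_le_of_fourthMoment hα)
  have hsum : ∑ j, I.covariateSpectrum M t j * I.coordError γ M j t ≤ 4 :=
    (sum_le_sum fun j _ => mul_le_of_le_one_right (hs j) (ht j)).trans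
      (I.sum_covariateSpectrum_le h0 h1)
  refine (I.coordError_succ_le hα γ M t i).trans ?_
  have := hs i
  gcongr _ + _ * (1 + ?_)
  linarith [mul_le_mul_of_nonneg_left hsum hα0]

lemma mul_le_two_of_mem_Icc (hα : I.FourthMoment α) {c : ℝ} (hc : c ∈ Set.Icc 0 (2 / (1 + 4 * α))) :
    c * (1 + 4 * α) ≤ 2 :=
  (le_div_iff₀ (by linarith [I.one_le_of_fourthMoment hα])).1 hc.2

lemma two_mul_le_one_of_mem_Icc (hα : I.FourthMoment α) {c : ℝ}
    (hc : c ∈ Set.Icc 0 (2 / (1 + 4 * α))) : 2 * c ≤ 1 := by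
  linarith [I.mul_le_two_of_mem_Icc hα hc,
    mul_le_mul_of_nonneg_left (I.one_le_of_fourthMoment hα) hc.1]

lemma coordError_le_one (hα : I.FourthMoment α) (h0 : 0 < ε) (h1 : ε < 1)
    (hγ : ∀ t, γ t ∈ Set.Icc 0 (2 / (1 + 4 * α))) : I.coordError γ M i t ≤ 1 := by
  induction t generalizing i with
  | zero => exact I.coordError_initial_le_one h0 h1
  | succ t ih =>
    refine (I.coordError_succ_le_of_le_one hα h0 h1 (fun j => ih) i).trans ?_
    obtain ⟨hs0, hs1⟩ := I.covariateSpectrum_mem_Icc (M := M) (t := t) (i := i) h0 h1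
    set s := I.covariateSpectrum M t i
    have hγs : 0 ≤ γ t * s := mul_nonneg (hγ t).1 hs0
    have hγs1 : 2 * γ t * s ≤ 1 :=
      mul_le_one₀ (I.two_mul_le_one_of_mem_Icc hα (hγ t)) hs0 hs1
    calc (1 - 2 * γ t * s) * I.coordError γ M i t + γ t ^ 2 * s * (1 + 4 * α)
        = (1 - 2 * γ t * s) * I.coordError γ M i t + γ t * s * (γ t * (1 + 4 * α)) := by ring
      _ ≤ (1 - 2 * γ t * s) * 1 + γ t * s * 2 := by
          gcongr
          exacts [ih, I.mul_le_two_of_mem_Icc hα (hγ t)]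
      _ = 1 := by ring

lemma coordError_source_eq_zero (hα : I.FourthMoment α) (h0 : 0 < ε) (h1 : ε < 1) (hi0 : i ≠ 0)
    (hi1 : i ≠ 1) (ht : t ≤ M) : I.coordError γ M i t = 0 := by
  induction t with
  | zero => rw [coordError_initial, I.inner_e_wStar h0 h1, if_neg (by tauto), zero_pow two_ne_zero]
  | succ t ih =>
    have h := I.coordError_succ_le hα γ M t i
    rw [I.covariateSpectrum_source ht, sourceSpectrum_of_ne hi0 hi1,
      ih (Nat.le_of_succ_le ht)] at h
    exact le_antisymm (by linarith) I.coordError_nonneg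

lemma coordError_target_le (hα : I.FourthMoment α) (h0 : 0 < ε) (h1 : ε < 1)
    (hγ : ∀ t, γ t ∈ Set.Icc 0 (2 / (1 + 4 * α))) {h : ℝ} (hh : ∀ n, γ (M + n) ≤ h) (hi : i ≠ 0) :
    I.coordError γ M i (M + n)
      ≤ I.coordError γ M i M + n * (h ^ 2 * ε ^ (1 / 2 : ℝ) * (1 + 4 * α)) := by
  induction n with
  | zero => simp
  | succ n ih =>
    have hα1 := I.one_le_of_fourthMoment hα
    have hstep := I.coordError_succ_le_of_le_one hα h0 h1 (M := M) (t := M + n)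
      (fun _ => I.coordError_le_one hα h0 h1 hγ) i
    rw [I.covariateSpectrum_target (Nat.le_add_right M n), targetSpectrum_of_ne_zero hi] at hstep
    have hγn := (hγ (M + n)).1
    have hcontract : 0 ≤ 2 * γ (M + n) * ε ^ (1 / 2 : ℝ) * I.coordError γ M i (M + n) :=
      mul_nonneg (by positivity) I.coordError_nonneg
    have hnoise : γ (M + n) ^ 2 * ε ^ (1 / 2 : ℝ) * (1 + 4 * α)
        ≤ h ^ 2 * ε ^ (1 / 2 : ℝ) * (1 + 4 * α) := by
      gcongr
      exact hh n
    push_cast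
    rw [← add_assoc M]
    linarith

lemma sum_coordError_target_le (hα : I.FourthMoment α) (h0 : 0 < ε) (h1 : ε < 1)
    (hγ : ∀ t, γ t ∈ Set.Icc 0 (2 / (1 + 4 * α))) {h : ℝ} (hh : ∀ n, γ (M + n) ≤ h) :
    ∑ i : Fin I.K, I.coordError γ M i.succ (M + n)
      ≤ I.coordError γ M 1 M + 3 * (n * h ^ 2 * (1 + 4 * α)) := by
  have hα1 := I.one_le_of_fourthMoment hα
  obtain ⟨i₁, hi₁⟩ := Fin.exists_succ_eq.2 (I.one_ne_zero_index h0 h1)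
  have hsource : ∑ i : Fin I.K, I.coordError γ M i.succ M = I.coordError γ M 1 M := by
    rw [sum_eq_single i₁ (fun i _ hi => I.coordError_source_eq_zero hα h0 h1 i.succ_ne_zero
      (fun h => hi (Fin.succ_injective _ (h.trans hi₁.symm))) le_rfl) (by simp), hi₁]
  calc ∑ i : Fin I.K, I.coordError γ M i.succ (M + n)
      ≤ ∑ i : Fin I.K, (I.coordError γ M i.succ M
          + n * (h ^ 2 * ε ^ (1 / 2 : ℝ) * (1 + 4 * α))) :=
        sum_le_sum fun i _ => I.coordError_target_le hα h0 h1 hγ hh i.succ_ne_zero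
    _ = I.coordError γ M 1 M + I.K * ε ^ (1 / 2 : ℝ) * (n * h ^ 2 * (1 + 4 * α)) := by
        rw [sum_add_distrib, hsource, sum_const, card_univ, Fintype.card_fin, nsmul_eq_mul]
        ring
    _ ≤ _ := by
        gcongr
        exact I.K_mul_rpow_half_le h0 h1

end Stability

section Finetuning

variable {E : Type*} [NormedAddCommGroup E] [InnerProductSpace ℝ E] [MeasurableSpace E]
  [BorelSpace E] [SecondCountableTopology E] {ε : ℝ} (I : ShiftInstance ε E) {α γ₀ γM : ℝ}
  {M N ℓ : ℕ}

lemma coordError_one_source_le (hα : I.FourthMoment α) (h0 : 0 < ε) (h1 : ε < 1)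
    (hγ₀ : γ₀ ∈ Set.Icc 0 (2 / (1 + 4 * α))) (hγM : γM ∈ Set.Icc 0 (2 / (1 + 4 * α)))
    (hℓ : ℓ + 1 ≤ Real.log M) :
    I.coordError (stepSize γ₀ γM M N) M 1 M
      ≤ Real.exp (-(2 * (γ₀ / 2 ^ ℓ) * (M / Real.log M - 1))) + γ₀ / 2 ^ ℓ * (1 + 4 * α) := by
  have hα1 := I.one_le_of_fourthMoment hα
  have hle_one (t : ℕ) (i : Fin (I.K + 1)) : I.coordError (stepSize γ₀ γM M N) M i t ≤ 1 :=
    I.coordError_le_one hα h0 h1 (stepSize_mem_Icc hγ₀ hγM)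
  refine (le_of_geometric_stage (u := I.coordError (stepSize γ₀ γM M N) M 1) (C := 1 + 4 * α)
    (stageLength_pos hℓ) hγ₀.1 (I.two_mul_le_one_of_mem_Icc hα hγ₀) (by linarith)
    (fun _ => I.coordError_nonneg) (add_one_mul_stageLength_le hℓ) fun t ht => ?_).trans ?_
  · have h := I.coordError_succ_le_of_le_one hα h0 h1 (hle_one t) 1
    rwa [I.covariateSpectrum_source ht, I.sourceSpectrum_one h0 h1, mul_one, mul_one,
      stepSize_source ht] at h
  · gcongr
    exact mul_le_of_le_one_right (Real.exp_nonneg _) (hle_one _ 1)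

lemma coordError_zero_target_le (hα : I.FourthMoment α) (h0 : 0 < ε) (h1 : ε < 1)
    (hγ₀ : γ₀ ∈ Set.Icc 0 (2 / (1 + 4 * α))) (hγM : γM ∈ Set.Icc 0 (2 / (1 + 4 * α)))
    (hℓ : 1 ≤ ℓ) (hℓN : ℓ + 1 ≤ Real.log N) :
    I.coordError (stepSize γ₀ γM M N) M 0 (M + N)
      ≤ Real.exp (-(2 * (γM / 2 ^ ℓ) * (N / Real.log N - 1)))
        * (Real.exp (-(2 * γM * (N / Real.log N - 1))) + γM * (1 + 4 * α))
        + γM / 2 ^ ℓ * (1 + 4 * α) := by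
  have hα1 := I.one_le_of_fourthMoment hα
  have hle_one (t : ℕ) (i : Fin (I.K + 1)) : I.coordError (stepSize γ₀ γM M N) M i t ≤ 1 :=
    I.coordError_le_one hα h0 h1 (stepSize_mem_Icc hγ₀ hγM)
  refine (le_of_two_geometric_stages
    (u := fun n => I.coordError (stepSize γ₀ γM M N) M 0 (M + n)) (C := 1 + 4 * α)
    (stageLength_pos hℓN) hγM.1 (I.two_mul_le_one_of_mem_Icc hα hγM) (by linarith)
    (fun _ => I.coordError_nonneg) hℓ (add_one_mul_stageLength_le hℓN) fun n _ => ?_).trans ?_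
  · have h := I.coordError_succ_le_of_le_one hα h0 h1 (hle_one (M + n)) 0
    rwa [I.covariateSpectrum_target (Nat.le_add_right M n), targetSpectrum_zero, mul_one, mul_one,
      stepSize_target] at h
  · gcongr
    exact mul_le_of_le_one_right (Real.exp_nonneg _) (hle_one _ 0)

lemma iterateRisk_lt (h0 : 0 < ε) {γ : ℕ → ℝ} {n : ℕ}
    (hlead : I.coordError γ M 0 n ≤ 1 / 10 * ε)
    (htail : ∑ i : Fin I.K, I.coordError γ M i.succ n ≤ 1 / 10 * ε ^ (1 / 2 : ℝ)) :
    I.iterateRisk γ M n < ε := by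
  have hr : 0 < ε ^ (1 / 2 : ℝ) := by positivity
  rw [iterateRisk_eq_sum, sum_targetSpectrum_mul]
  linarith [mul_le_mul_of_nonneg_left htail hr.le, rpow_half_sq h0]

lemma mem_Icc_of_lt_one_div_traceG (hα : I.FourthMoment α) (h0 : 0 < ε) (h1 : ε < 1) {γ : ℝ}
    (hγ0 : 0 ≤ γ) (hγ : γ < 1 / (4 * α * I.traceG)) : γ ∈ Set.Icc 0 (2 / (1 + 4 * α)) := by
  have hα1 := I.one_le_of_fourthMoment hα
  refine ⟨hγ0, hγ.le.trans ?_⟩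
  rw [div_le_div_iff₀ (by have := (I.traceG_mem_Icc h0 h1).1; positivity) (by linarith)]
  nlinarith [mul_le_mul_of_nonneg_left (I.traceG_mem_Icc h0 h1).1 (zero_le_one.trans hα1)]

theorem eventually_iterateRisk_lt {α a₀ a₁ a₂ a₃ : ℝ} (b₁ b₃ : ℝ) (hα : 0 < α) (ha₀ : 0 < a₀)
    (ha₁ : 0 < a₁) (ha₂ : 0 < a₂) (ha₃ : 0 < a₃) (hκ : 2 ≤ a₁ * a₃) :
    ∀ᶠ ε : ℝ in 𝓝[>] 0, ∀ (E : Type*) [NormedAddCommGroup E] [InnerProductSpace ℝ E]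
      [SecondCountableTopology E] [MeasurableSpace E] [BorelSpace E] (I : ShiftInstance ε E),
      I.FourthMoment α → ∀ (γ₀ γM : ℝ) (M N : ℕ), a₀ ≤ γ₀ → γ₀ < 1 / (4 * α * I.traceG) →
      a₁ * ε ≤ γM → γM ≤ b₁ * ε → a₂ * (ε⁻¹ * Real.log ε⁻¹) ≤ M →
      a₃ * (ε⁻¹ * Real.log ε⁻¹ ^ 2) ≤ N → N ≤ b₃ * (ε⁻¹ * Real.log ε⁻¹ ^ 2) →
      I.iterateRisk (stepSize γ₀ γM M N) M (M + N) < ε := by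
  have hC : 0 ≤ 1 + 4 * α := by positivity
  have hsmall : Tendsto (fun ε : ℝ => b₁ * ε) (𝓝[>] 0) (𝓝 0) :=
    ((continuous_const_mul b₁).tendsto' 0 0 (mul_zero b₁)).mono_left nhdsWithin_le_nhds
  filter_upwards [self_mem_nhdsWithin, nhdsWithin_le_nhds (eventually_lt_nhds one_pos),
    hsmall.eventually_le_const (show 0 < 2 / (1 + 4 * α) by positivity),
    tendsto_inv_nhdsGT_zero.eventually (eventually_exists_geometric_stage_of_mul_log_le
      ha₀ ha₂ hC (show (0 : ℝ) < 1 / 20 by norm_num)),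
    tendsto_inv_nhdsGT_zero.eventually (eventually_exists_two_geometric_stages
      b₁ b₃ ha₁ ha₃ hκ hC (show (0 : ℝ) < 1 / 10 by norm_num)),
    tendsto_inv_nhdsGT_zero.eventually (eventually_mul_sq_mul_le_rpow
      b₁ b₃ hC (show (0 : ℝ) < 1 / 60 by norm_num))]
    with ε h0 h1 hstable hsource htarget htail E _ _ _ _ _ I hfourth γ₀ γM M N
      hγ₀ hγ₀' hγM hγM' hM hN hN'
  replace h0 : 0 < ε := h0
  have hγM0 : 0 ≤ γM := le_trans (by positivity) hγM
  have hstable₀ := I.mem_Icc_of_lt_one_div_traceG hfourth h0 h1 (ha₀.le.trans hγ₀) hγ₀'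
  have hstableM : γM ∈ Set.Icc 0 (2 / (1 + 4 * α)) := ⟨hγM0, hγM'.trans hstable⟩
  have hγ₀1 : γ₀ ≤ 1 := by linarith [I.two_mul_le_one_of_mem_Icc hfourth hstable₀]
  simp only [inv_inv, Real.inv_rpow h0.le, Real.rpow_neg h0.le] at hsource htarget htail
  obtain ⟨ℓ, hℓ, hbias₁⟩ := hsource γ₀ M hγ₀ hγ₀1 hM
  obtain ⟨k, hk, hkN, hbias₀⟩ := htarget γM N hγM hγM' hN hN'
  refine I.iterateRisk_lt h0 ((I.coordError_zero_target_le hfourth h0 h1 hstable₀ hstableM hk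
    hkN).trans hbias₀) ((I.sum_coordError_target_le hfourth h0 h1
      (stepSize_mem_Icc hstable₀ hstableM) (stepSize_target_le hγM0)).trans ?_)
  linarith [I.coordError_one_source_le (N := N) hfourth h0 h1 hstable₀ hstableM hℓ,
    htail γM N hγM0 hγM' N.cast_nonneg hN']

end Finetuning

end ShiftInstance

theorem mainTheorem7_general :
    (∃ c > (0 : ℝ), ∃ C > (0 : ℝ), ∃ ε₀ > (0 : ℝ), ∀ ε : ℝ, 0 < ε → ε < ε₀ →
      ∀ (E : Type*) [NormedAddCommGroup E] [InnerProductSpace ℝ E] [MeasurableSpace E]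
        (I : ShiftInstance ε E),
      (c ≤ I.traceH ∧ I.traceH ≤ C) ∧ (c ≤ I.traceG ∧ I.traceG ≤ C) ∧
      (c ≤ normSqOp I.H I.wStar ∧ normSqOp I.H I.wStar ≤ C) ∧
      (c ≤ normSqOp I.G I.wStar ∧ normSqOp I.G I.wStar ≤ C)) ∧
    (∃ c > (0 : ℝ), ∃ ε₀ > (0 : ℝ), ∀ ε : ℝ, 0 < ε → ε < ε₀ →
      ∀ (E : Type*) [NormedAddCommGroup E] [InnerProductSpace ℝ E]
        [SecondCountableTopology E] [MeasurableSpace E] [BorelSpace E] (I : ShiftInstance ε E)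
        (N : ℕ) (γ : ℕ → ℝ),
      I.iterateRisk γ 0 N < ε → c * ε ^ (-(3 / 2) : ℝ) ≤ N) ∧
    (∃ c > (0 : ℝ), ∃ ε₀ > (0 : ℝ), ∀ ε : ℝ, 0 < ε → ε < ε₀ →
      ∀ (E : Type*) [NormedAddCommGroup E] [InnerProductSpace ℝ E]
        [SecondCountableTopology E] [MeasurableSpace E] [BorelSpace E] (I : ShiftInstance ε E)
        (M : ℕ) (γ : ℕ → ℝ), (∀ t < M, γ t ≤ 1 / ‖I.G‖) →
      I.iterateRisk γ M M < ε → c * ε ^ (-2 : ℝ) ≤ M) ∧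
    (∃ κ > (0 : ℝ), ∀ α a₀ a₁ b₁ a₂ a₃ b₃ : ℝ, 0 < α → 0 < a₀ → 0 < a₁ → 0 < a₂ → 0 < a₃ →
      κ ≤ a₁ * a₃ →
      ∃ ε₀ > (0 : ℝ), ∀ ε : ℝ, 0 < ε → ε < ε₀ →
      ∀ (E : Type*) [NormedAddCommGroup E] [InnerProductSpace ℝ E]
        [SecondCountableTopology E] [MeasurableSpace E] [BorelSpace E] (I : ShiftInstance ε E),
      I.FourthMoment α →
      ∀ (γ₀ γM : ℝ) (M N : ℕ),
      a₀ ≤ γ₀ → γ₀ < 1 / (4 * α * I.traceG) → a₁ * ε ≤ γM → γM ≤ b₁ * ε →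
      a₂ * (ε⁻¹ * Real.log ε⁻¹) ≤ M →
      a₃ * (ε⁻¹ * Real.log ε⁻¹ ^ 2) ≤ N → N ≤ b₃ * (ε⁻¹ * Real.log ε⁻¹ ^ 2) →
      Integrable (I.outputRisk γ₀ γM M N) (I.dataMeasure M) ∧
        I.expectedRisk γ₀ γM M N < ε) := by
  refine ⟨⟨1, one_pos, 4, four_pos, 1, one_pos, fun ε h0 h1 E _ _ _ I => ?_⟩,
    ⟨1 / 8, by norm_num, 1 / 64, by norm_num, fun ε h0 h1 E _ _ _ _ _ I N γ =>
      I.le_samples_of_supervised h0 h1⟩,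
    ⟨1 / 2, by norm_num, 1 / 8, by norm_num, fun ε h0 h1 E _ _ _ _ _ I M γ =>
      I.le_samples_of_pretraining h0 h1⟩,
    2, two_pos, fun α a₀ a₁ b₁ a₂ a₃ b₃ hα ha₀ ha₁ ha₂ ha₃ hκ => ?_⟩
  · exact ⟨I.traceH_mem_Icc h0 h1, I.traceG_mem_Icc h0 h1, I.normSqOp_H_wStar_mem_Icc h0 h1,
      I.normSqOp_G_wStar_mem_Icc h0 h1⟩
  · obtain ⟨ε₀, hε₀, hrisk⟩ := exists_pos_forall_of_eventually_nhdsGT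
      (ShiftInstance.eventually_iterateRisk_lt b₁ b₃ hα ha₀ ha₁ ha₂ ha₃ hκ)
    exact ⟨ε₀, hε₀, fun ε h0 h1 E _ _ _ _ _ I hfourth γ₀ γM M N hγ₀ hγ₀' hγM hγM' hM hN hN' =>
      ⟨I.integrable_excessRisk_sgd,
        hrisk ε h0 h1 E I hfourth γ₀ γM M N hγ₀ hγ₀' hγM hγM' hM hN hN'⟩⟩

theorem mainTheorem7 :
    -- the orders of the traces and of the signal strengths
    (∃ c > (0 : ℝ), ∃ C > (0 : ℝ), ∃ ε₀ > (0 : ℝ), ∀ ε : ℝ, 0 < ε → ε < ε₀ →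
      ∀ (E : Type*) [NormedAddCommGroup E] [InnerProductSpace ℝ E] [CompleteSpace E]
        [SecondCountableTopology E] [MeasurableSpace E] [BorelSpace E] (I : ShiftInstance ε E),
      (c ≤ I.traceH ∧ I.traceH ≤ C) ∧ (c ≤ I.traceG ∧ I.traceG ≤ C) ∧
      (c ≤ normSqOp I.H I.wStar ∧ normSqOp I.H I.wStar ≤ C) ∧
      (c ≤ normSqOp I.G I.wStar ∧ normSqOp I.G I.wStar ≤ C)) ∧
    -- supervised learning
    (∃ c > (0 : ℝ), ∃ ε₀ > (0 : ℝ), ∀ ε : ℝ, 0 < ε → ε < ε₀ →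
      ∀ (E : Type*) [NormedAddCommGroup E] [InnerProductSpace ℝ E] [CompleteSpace E]
        [SecondCountableTopology E] [MeasurableSpace E] [BorelSpace E] (I : ShiftInstance ε E)
        (N : ℕ) (γ : ℝ), 0 < γ → γ < 1 / ‖I.H‖ →
      I.expectedRisk γ γ 0 N < ε → c * ε ^ (-(3 / 2) : ℝ) ≤ N) ∧
    -- pretraining
    (∃ c > (0 : ℝ), ∃ ε₀ > (0 : ℝ), ∀ ε : ℝ, 0 < ε → ε < ε₀ →
      ∀ (E : Type*) [NormedAddCommGroup E] [InnerProductSpace ℝ E] [CompleteSpace E]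
        [SecondCountableTopology E] [MeasurableSpace E] [BorelSpace E] (I : ShiftInstance ε E)
        (M : ℕ) (γ : ℝ), 0 < γ → γ < 1 / ‖I.G‖ →
      I.expectedRisk γ γ M 0 < ε → c * ε ^ (-2 : ℝ) ≤ M) ∧
    -- pretraining-finetuning
    (∃ κ > (0 : ℝ), ∀ α a₀ a₁ b₁ a₂ b₂ a₃ b₃ : ℝ, 0 < α → 0 < a₀ → 0 < a₁ → 0 < a₂ → 0 < a₃ →
      κ ≤ a₁ * a₃ →
      ∃ ε₀ > (0 : ℝ), ∀ ε : ℝ, 0 < ε → ε < ε₀ →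
      ∀ (E : Type*) [NormedAddCommGroup E] [InnerProductSpace ℝ E] [CompleteSpace E]
        [SecondCountableTopology E] [MeasurableSpace E] [BorelSpace E] (I : ShiftInstance ε E),
      I.FourthMoment α →
      ∀ (γ₀ γM : ℝ) (M N : ℕ),
      a₀ ≤ γ₀ → γ₀ < 1 / (4 * α * I.traceG) → γ₀ < 1 / (4 * α * I.traceH) →
      a₁ * ε ≤ γM → γM ≤ b₁ * ε →
      a₂ * (ε⁻¹ * Real.log ε⁻¹) ≤ M → M ≤ b₂ * (ε⁻¹ * Real.log ε⁻¹) →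
      a₃ * (ε⁻¹ * Real.log ε⁻¹ ^ 2) ≤ N → N ≤ b₃ * (ε⁻¹ * Real.log ε⁻¹ ^ 2) →
      Integrable (I.outputRisk γ₀ γM M N) (I.dataMeasure M) ∧
        I.expectedRisk γ₀ γM M N < ε) := by
  obtain ⟨⟨c, hc, C, hC, δ, hδ, hsize⟩, ⟨c', hc', δ', hδ', hsupervised⟩,
    ⟨c'', hc'', δ'', hδ'', hpretraining⟩, κ, hκ, hfinetuning⟩ := mainTheorem7_general
  refine ⟨⟨c, hc, C, hC, δ, hδ, fun ε h0 h1 E _ _ _ _ _ _ I => hsize ε h0 h1 E I⟩,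
    ⟨c', hc', δ', hδ', fun ε h0 h1 E _ _ _ _ _ _ I N γ _ _ hrisk => ?_⟩,
    ⟨c'', hc'', δ'', hδ'', fun ε h0 h1 E _ _ _ _ _ _ I M γ h hγ => ?_⟩,
    κ, hκ, fun α a₀ a₁ b₁ a₂ _ a₃ b₃ hα ha₀ ha₁ ha₂ ha₃ ha => ?_⟩
  · have hrisk : I.iterateRisk (stepSize γ γ 0 N) 0 (0 + N) < ε := hrisk
    rw [zero_add] at hrisk
    exact hsupervised ε h0 h1 E I N _ hrisk
  · exact hpretraining ε h0 h1 E I M (stepSize γ γ M 0) fun t ht =>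
      (stepSize_source_le h.le ht).trans hγ.le
  · obtain ⟨ε₀, hε₀, hrisk⟩ := hfinetuning α a₀ a₁ b₁ a₂ a₃ b₃ hα ha₀ ha₁ ha₂ ha₃ ha
    exact ⟨ε₀, hε₀, fun ε h0 h1 E _ _ _ _ _ _ I hfourth γ₀ γM M N hγ₀ hγ₀' _ hγM hγM' hM _ =>
      hrisk ε h0 h1 E I hfourth γ₀ γM M N hγ₀ hγ₀' hγM hγM' hM⟩
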